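/- Let $\mathbf{k}$ be a field and let $\mathcal{C}$ be a tensor category over $\mathbf{k}$, i.e. a rigid abelian $\mathbf{k}$-linear monoidal category with bilinear tensor product, in which every object has finite length and $\mathbf{k}\to\mathrm{End}(\mathbb{1})$ is an isomorphism. For $X\in\mathcal{C}$ let $X^*$ be the dual with evaluation $\mathrm{ev}_X:X^*\otimes X\to\mathbb{1}$ and coevaluation $\mathrm{co}_X:\mathbb{1}\to X\otimes X^*$, and put $X^{(0)}=X$, $X^{(n+1)}=(X^{(n)})^*$. Define complexes $\mathbb{E}_n(X)$ in $\mathcal{C}$ and chain maps $f_n:X^{(n)}\otimes\mathbb{E}_n(X)\to\mathbb{E}_{n-1}(X)$ by $\mathbb{E}_0(X)=\mathbb{1}[0]$, $\mathbb{E}_1(X)=X[0]$, $f_1=\mathrm{ev}_X$ and, for $n\ge1$, $\mathbb{E}_{n+1}(X)=\mathrm{Cone}(f_n)[-1]$, with $f_{n+1}$ adjoint to the canonical map $\mathbb{E}_{n+1}(X)\to X^{(n)}\otimes\mathbb{E}_n(X)$. Dually, define $\mathbb{E}^n(X)$ and $g_n:\mathbb{E}^{n-1}(X)\to\mathbb{E}^n(X)\otimes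 X^{(n)}$ by $\mathbb{E}^0(X)=\mathbb{1}[0]$, $\mathbb{E}^1(X)=X[0]$, $g_1=\mathrm{co}_X$ and, for $n\ge 1$, $\mathbb{E}^{n+1}(X)=\mathrm{Cone}(g_n)$, with $g_{n+1}$ adjoint to the canonical map $\mathbb{E}^n(X)\otimes X^{(n)}\to\mathbb{E}^{n+1}(X)$. For an integer $N\ge1$, the object $X$ is called *$N$-bounded* if $\mathbb{E}_{N-1}(X)$ and $\mathbb{E}^{N-1}(X)$ are acyclic (which expresses that the functor $-\otimes X$ on the derived category is $N$-spherical), *strictly $N$-bounded* if it is $N$-bounded but not $N'$-bounded for any $1\le N'<N$, and *unbounded* if it is not $N$-bounded for any $N\ge1$. Let $\ell$ denote the length of objects, and set $$\mathsf{gd}(Y)=\lim_{i\to\infty}\ell(Y^{\otimes i})^{1/i}\in[0,\infty],\qquad \mathbf{D}(X)=\sqrt{\mathsf{gd}(X^*\otimes X)}\in[0,\infty].$$ Theorem. Let $X\in\mathcal{C}$ with $X^{**}\cong X$ and let $N\ge1$ be an integer. Then the limit defining $\mathsf{gd}(X^*\otimes X)$ exists in $[0,\infty]$, and 1. $X$ is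 strictly $N$-bounded if and only if $\mathbf{D}(X)=2\cos(\pi/N)$; 2. $X$ is unbounded if and only if $\mathbf{D}(X)\ge2$. -/

import Mathlib

open CategoryTheory MonoidalCategory Filter Topology
open scoped ENNReal

universe w v u

namespace TensorBounded

/-- The length of an object of an abelian category: the supremum of the lengths of finite
strictly ascending chains of subobjects. -/
noncomputable def objLength {C : Type u} [Category.{v} C] (X : C) : ℕ∞ :=
  ⨆ p : LTSeries (Subobject X), (p.length : ℕ∞)

/-- A tensor category over the field `k`: a rigid abelian `k`-linear monoidal category (with
bilinear tensor product) in which every object has finite length and `k → End(𝟙)` is an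
isomorphism. -/
class IsTensorCategory (k : Type w) [Field k] (C : Type u) [Category.{v} C] [Abelian C]
    [Linear k C] [MonoidalCategory C] [MonoidalPreadditive C] [MonoidalLinear k C]
    [RigidCategory C] : Prop where
  bijective_smul_id : Function.Bijective (fun a : k => a • 𝟙 (𝟙_ C))
  objLength_ne_top : ∀ X : C, objLength X ≠ ⊤

section Growth

variable {C : Type u} [Category.{v} C] [MonoidalCategory C]

/-- The tensor power `X^{⊗ i}`. -/
def tensorPow (X : C) : ℕ → C
  | 0 => 𝟙_ C
  | i + 1 => tensorPow X i ⊗ X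

/-- The sequence `ℓ(X^{⊗ i})^{1/i}` (of interest for `i ≥ 1`). -/
noncomputable def growthSeq (X : C) (i : ℕ) : ℝ≥0∞ :=
  (objLength (tensorPow X i) : ℝ≥0∞) ^ (1 / (i : ℝ))

/-- The growth dimension `gd(X) = lim_i ℓ(X^{⊗ i})^{1/i}` in `[0, ∞]`. -/
noncomputable def growthDim (X : C) : ℝ≥0∞ :=
  limUnder atTop (growthSeq X)

/-- `D(X) = sqrt(gd(X* ⊗ X))`, where `X*` is the dual with evaluation `X* ⊗ X ⟶ 𝟙`
(written `Xᘁ` in Mathlib). -/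
noncomputable def dualGrowth (X : C) [HasRightDual X] : ℝ≥0∞ :=
  growthDim (Xᘁ ⊗ X) ^ (1 / 2 : ℝ)

end Growth

section Complexes

variable {C : Type u} [Category.{v} C] [Abelian C]

/-- Transposition of chain maps along an adjunction `F ⊣ G`, from `K ⟶ G L` to `F K ⟶ L`,
applied in each degree. -/
def transposeLeft {F G : C ⥤ C} [F.Additive] [G.Additive] (adj : F ⊣ G)
    {K L : CochainComplex C ℤ}
    (φ : K ⟶ (G.mapHomologicalComplex (ComplexShape.up ℤ)).obj L) :
    (F.mapHomologicalComplex (ComplexShape.up ℤ)).obj K ⟶ L where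
  f i := (adj.homEquiv (K.X i) (L.X i)).symm (φ.f i)
  comm' i j _ := by
    have h := φ.comm i j
    exact (adj.homEquiv_naturality_right_symm (φ.f i) (L.d i j)).symm.trans
      ((congrArg (adj.homEquiv (K.X i) (L.X j)).symm h).trans
        (adj.homEquiv_naturality_left_symm (K.d i j) (φ.f j)))

/-- Transposition of chain maps along an adjunction `F ⊣ G`, from `F K ⟶ L` to `K ⟶ G L`,
applied in each degree. -/
def transposeRight {F G : C ⥤ C} [F.Additive] [G.Additive] (adj : F ⊣ G)
    {K L : CochainComplex C ℤ}
    (φ : (F.mapHomologicalComplex (ComplexShape.up ℤ)).obj K ⟶ L) :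
    K ⟶ (G.mapHomologicalComplex (ComplexShape.up ℤ)).obj L where
  f i := adj.homEquiv (K.X i) (L.X i) (φ.f i)
  comm' i j _ := by
    have h := φ.comm i j
    exact (adj.homEquiv_naturality_right (φ.f i) (L.d i j)).symm.trans
      ((congrArg (adj.homEquiv (K.X i) (L.X j)) h).trans
        (adj.homEquiv_naturality_left (K.d i j) (φ.f j)))

/-- `Cone(f)[-1]`. -/
noncomputable def coconeComplex {K L : CochainComplex C ℤ} (f : K ⟶ L) : CochainComplex C ℤ :=
  (CochainComplex.mappingCone f)⟦(-1 : ℤ)⟧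

/-- The canonical chain map `Cone(f)[-1] ⟶ K` for `f : K ⟶ L`, the first map of the triangle
`Cone(f)[-1] ⟶ K ⟶ L ⟶`. -/
noncomputable def coconeMap {K L : CochainComplex C ℤ} (f : K ⟶ L) : coconeComplex f ⟶ K :=
  (CochainComplex.mappingCone.triangle f).invRotate.mor₁

/-- The complex `X[0]`, with `X` in degree `0`. -/
noncomputable def inDegreeZero (X : C) : CochainComplex C ℤ :=
  (HomologicalComplex.single C (ComplexShape.up ℤ) 0).obj X

variable [MonoidalCategory C] [MonoidalPreadditive C] [RightRigidCategory C]

/-- The iterated dual `X^{(n)} = X^{*⋯*}`. -/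
def iterDual (X : C) : ℕ → C
  | 0 => X
  | n + 1 => (iterDual X n)ᘁ

/-- `X^{(n)}` and `X^{(n+1)} = (X^{(n)})*` are dual to each other, with evaluation
`X^{(n+1)} ⊗ X^{(n)} ⟶ 𝟙` and coevaluation `𝟙 ⟶ X^{(n)} ⊗ X^{(n+1)}`. -/
noncomputable instance iterDualPairing (X : C) (n : ℕ) :
    ExactPairing (iterDual X n) (iterDual X (n + 1)) :=
  inferInstanceAs (ExactPairing (iterDual X n) (iterDual X n)ᘁ)

/-- The functor `Y ⊗ -` on complexes. -/
noncomputable abbrev leftTensor (Y : C) : CochainComplex C ℤ ⥤ CochainComplex C ℤ :=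
  (tensorLeft Y).mapHomologicalComplex (ComplexShape.up ℤ)

/-- The functor `- ⊗ Y` on complexes. -/
noncomputable abbrev rightTensor (Y : C) : CochainComplex C ℤ ⥤ CochainComplex C ℤ :=
  (tensorRight Y).mapHomologicalComplex (ComplexShape.up ℤ)

/-- Two successive complexes `E_n(X)`, `E_{n+1}(X)` with
`f_{n+1} : X^{(n+1)} ⊗ E_{n+1}(X) ⟶ E_n(X)`. -/
structure LowerStage (X : C) (n : ℕ) where
  prev : CochainComplex C ℤ
  next : CochainComplex C ℤ
  map : (leftTensor (iterDual X (n + 1))).obj next ⟶ prev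

/-- The recursion defining the continuant complexes `E_n(X)`: start with `E_0(X) = 𝟙[0]`,
`E_1(X) = X[0]` and `f_1 = ev_X`; then `E_{n+1}(X) = Cone(f_n)[-1]` and `f_{n+1}` is adjoint
to the canonical map `E_{n+1}(X) ⟶ X^{(n)} ⊗ E_n(X)`. -/
noncomputable def lowerStage (X : C) : (n : ℕ) → LowerStage X n
  | 0 =>
    { prev := inDegreeZero (𝟙_ C)
      next := inDegreeZero X
      map :=
        (HomologicalComplex.singleMapHomologicalComplex (tensorLeft (iterDual X 1))
            (ComplexShape.up ℤ) 0).hom.app X ≫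
          (HomologicalComplex.single C (ComplexShape.up ℤ) 0).map (ε_ X (Xᘁ)) }
  | n + 1 =>
    { prev := (lowerStage X n).next
      next := coconeComplex (lowerStage X n).map
      map := transposeLeft (tensorLeftAdjunction (iterDual X (n + 1)) (iterDual X (n + 2)))
        (coconeMap (lowerStage X n).map) }

/-- The continuant complex `E_n(X)`, in cohomological indexing: it starts with
`X^{(n-1)} ⊗ ⋯ ⊗ X* ⊗ X` in degree `0`, and the differentials are built from evaluations. -/
noncomputable def lowerContinuant (X : C) (n : ℕ) : CochainComplex C ℤ :=
  (lowerStage X n).prev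

/-- Two successive complexes `E^n(X)`, `E^{n+1}(X)` with
`g_{n+1} : E^n(X) ⟶ E^{n+1}(X) ⊗ X^{(n+1)}`. -/
structure UpperStage (X : C) (n : ℕ) where
  prev : CochainComplex C ℤ
  next : CochainComplex C ℤ
  map : prev ⟶ (rightTensor (iterDual X (n + 1))).obj next

/-- The recursion defining the dual continuant complexes `E^n(X)`: start with `E^0(X) = 𝟙[0]`,
`E^1(X) = X[0]` and `g_1 = co_X`; then `E^{n+1}(X) = Cone(g_n)` and `g_{n+1}` is adjoint to the
canonical map `E^n(X) ⊗ X^{(n)} ⟶ E^{n+1}(X)`. -/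
noncomputable def upperStage (X : C) : (n : ℕ) → UpperStage X n
  | 0 =>
    { prev := inDegreeZero (𝟙_ C)
      next := inDegreeZero X
      map :=
        (HomologicalComplex.single C (ComplexShape.up ℤ) 0).map (η_ X (Xᘁ)) ≫
          (HomologicalComplex.singleMapHomologicalComplex (tensorRight (iterDual X 1))
            (ComplexShape.up ℤ) 0).inv.app X }
  | n + 1 =>
    { prev := (upperStage X n).next
      next := CochainComplex.mappingCone (upperStage X n).map
      map := transposeRight (tensorRightAdjunction (iterDual X (n + 1)) (iterDual X (n + 2)))
        (CochainComplex.mappingCone.inr (upperStage X n).map) }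

/-- The dual continuant complex `E^n(X)`, in cohomological indexing: it ends with
`X ⊗ X* ⊗ ⋯ ⊗ X^{(n-1)}` in degree `0`, and the differentials are built from coevaluations. -/
noncomputable def upperContinuant (X : C) (n : ℕ) : CochainComplex C ℤ :=
  (upperStage X n).prev

/-- `X` is `N`-bounded, for `N ≥ 1`: the complexes `E_{N-1}(X)` and `E^{N-1}(X)` vanish in the
derived category. This says that the endofunctors `- ⊗ E_{N-1}(X)` and `- ⊗ E^{N-1}(X)` of the
derived category, which are the continuants of `- ⊗ X` and its iterated adjoints, vanish, i.e.
that `- ⊗ X` is an `N`-spherical functor. -/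
def IsNBounded (X : C) (N : ℕ) : Prop :=
  0 < N ∧ (lowerContinuant X (N - 1)).Acyclic ∧ (upperContinuant X (N - 1)).Acyclic

/-- `X` is strictly `N`-bounded: `N`-bounded and not `N'`-bounded for `N' < N`. -/
def IsStrictlyNBounded (X : C) (N : ℕ) : Prop :=
  IsNBounded X N ∧ ∀ N' < N, ¬ IsNBounded X N'

/-- `X` is unbounded: not `N`-bounded for any `N ≥ 1`. -/
def IsUnbounded (X : C) : Prop :=
  ∀ N : ℕ, ¬ IsNBounded X N

end Complexes

end TensorBounded

/-! Write E_n for the lower continuants. As long as no earlier E_j vanishes, the complex E_n is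
quasi-isomorphic to one object `lowerObj X n` in degree 0, an iterated kernel, because X^{(n+1)} ⊗
E_{n+1} → E_n is epi while E_0, …, E_{n+1} are nonzero (`epi_lower_map`); a shifted cone of an
epimorphism is its kernel.

For this surjectivity, let π : E_n → Q be the cokernel of the transition map f. Descending from E_n
to E_0 = 𝟙 (`Factorization.step`) produces an object P', a pairing P' ⊗ E_n → 𝟙 nondegenerate in
E_n, and an epi 𝟙 → P' ⊗ Q, with composite P' ⊗ π. The unit is simple (`simple_unit`). If the epi is
zero, then P' ⊗ Q = 0, and either factor vanishing gives Q = 0. Otherwise it is mono, so π is mono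
by nondegeneracy and f = 0; as the transpose of f is mono, E_{n+1} = 0. The argument is run for
abstract chains of adjoint functors, so that it covers both X^{(i)} ⊗ - on C and - ⊗ X^{(i)} on the
opposite category.

The kernel sequences give [E_{n+1}] = [X^{(n)}][E_n] - [E_{n-1}] in a ring of classes. Since X** ≅
X, the classes [X^{(n)}] are 2-periodic. This makes lower and upper continuants vanish first at the
same index (`isZero_lowerObj_iff_upperObj`), and it makes tensoring with X and X* alternately act on
the E_n as the adjacency matrix of a path. If E_m is the first zero term, the path has m vertices
(Dynkin type A_m), with Perron eigenvector sin(nπ/(m+1)) and eigenvalue 2cos(π/(m+1)); comparison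
with lengths gives D(X) = 2cos(π/(m+1)), with N = m + 1 the strict bound. If no term vanishes,
truncated paths give D(X) ≥ 2cos(π/(m+1)) for all m > 0, so D(X) ≥ 2. Since 2cos(π/N) < 2 and N is
determined by cos(π/N), both equivalences follow. -/

namespace TensorBounded

open CategoryTheory.Limits ZeroObject Opposite

/-! ### Length through chains of monomorphisms -/

section Length

variable {C : Type u} [Category.{v} C]

/-- `X` has a strictly ascending chain of `n + 1` subobjects ending with `X` itself. -/
def HasChain : ℕ → C → Prop
  | 0, _ => True
  | n + 1, X => ∃ (A : C) (i : A ⟶ X), Mono i ∧ ¬ IsIso i ∧ HasChain n A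

lemma HasChain.of_mono {n : ℕ} {A X : C} (h : HasChain n A) (i : A ⟶ X) [Mono i] :
    HasChain n X := by
  cases n with
  | zero => trivial
  | succ n =>
    obtain ⟨B, j, hj, hj', hB⟩ := h
    refine ⟨B, j ≫ i, mono_comp j i, fun hiso => hj' ?_, hB⟩
    have : IsSplitEpi i := ⟨⟨⟨inv (j ≫ i) ≫ j, by simp⟩⟩⟩
    have : IsIso i := isIso_of_mono_of_isSplitEpi i
    exact IsIso.of_isIso_comp_right j i

lemma hasChain_mono {m n : ℕ} (hmn : m ≤ n) {X : C} (h : HasChain n X) : HasChain m X := by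
  induction n generalizing m X with
  | zero => obtain rfl : m = 0 := by omega
            exact h
  | succ n ih =>
    cases m with
    | zero => trivial
    | succ m =>
      obtain ⟨B, j, hj, hj', hB⟩ := h
      exact ⟨B, j, hj, hj', ih (by omega) hB⟩

lemma HasChain.map {D : Type*} [Category D] (F : C ⥤ D) [F.PreservesMonomorphisms]
    [F.ReflectsIsomorphisms] {n : ℕ} {X : C} (h : HasChain n X) : HasChain n (F.obj X) := by
  induction n generalizing X with
  | zero => trivial
  | succ n ih =>
    obtain ⟨B, j, hj, hj', hB⟩ := h
    exact ⟨F.obj B, F.map j, inferInstance, fun _ => hj' (isIso_of_reflects_iso j F), ih hB⟩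

lemma hasChain_of_ltSeries {X : C} (n : ℕ) (p : LTSeries (Subobject X)) (hp : p.length = n) :
    HasChain n (p.last : C) := by
  induction n generalizing p with
  | zero => trivial
  | succ n ih =>
    have h1 : p.eraseLast.last < p.last := p.eraseLast_last_rel_last (by omega)
    refine ⟨_, Subobject.ofLE _ _ h1.le, inferInstance, fun hiso => ?_,
      ih p.eraseLast (by simp [hp])⟩
    refine h1.not_ge (Subobject.le_of_comm (inv (Subobject.ofLE _ _ h1.le)) ?_)
    rw [IsIso.inv_comp_eq, Subobject.ofLE_arrow]

lemma HasChain.exists_ltSeries {n : ℕ} {X : C} (h : HasChain n X) :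
    ∃ p : LTSeries (Subobject X), p.length = n := by
  induction n generalizing X with
  | zero => exact ⟨RelSeries.singleton _ (Subobject.mk (𝟙 X)), rfl⟩
  | succ n ih =>
    obtain ⟨A, i, hi, hi', hA⟩ := h
    obtain ⟨p, hp⟩ := ih hA
    have hmono : StrictMono (Subobject.map i).obj :=
      (Subobject.map i).monotone.strictMono_of_injective (Subobject.map_obj_injective i)
    have hlt : (p.map _ hmono).last < Subobject.mk (𝟙 X) := by
      have h1 : (p.map _ hmono).last ≤ Subobject.mk i := by
        rw [LTSeries.last_map, ← Subobject.mk_arrow p.last, Subobject.map_mk]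
        exact Subobject.mk_le_mk_of_comm p.last.arrow rfl
      refine lt_of_le_of_lt h1 (lt_of_le_of_ne (Subobject.mk_le_mk_of_comm i (by simp)) ?_)
      intro heq
      exact hi' ((Subobject.isIso_iff_mk_eq_top i).2 heq)
    exact ⟨(p.map _ hmono).snoc _ hlt, by simp [RelSeries.snoc, RelSeries.append, hp]⟩

lemma hasChain_iff_le_objLength (n : ℕ) (X : C) : HasChain n X ↔ (n : ℕ∞) ≤ objLength X := by
  constructor
  · intro h
    obtain ⟨p, hp⟩ := h.exists_ltSeries
    exact hp ▸ le_iSup (fun p : LTSeries (Subobject X) => (p.length : ℕ∞)) p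
  · intro h
    by_contra hn
    have hpos : 0 < n := by
      rcases Nat.eq_zero_or_pos n with rfl | h
      · exact absurd trivial hn
      · exact h
    have : objLength X ≤ ((n - 1 : ℕ) : ℕ∞) := by
      refine iSup_le fun p => ?_
      by_contra hlt
      have hlt' : n ≤ p.length := by
        have : n - 1 < p.length := Nat.cast_lt.1 (not_le.1 hlt)
        omega
      exact hn (hasChain_mono hlt' ((hasChain_of_ltSeries _ p rfl).of_mono p.last.arrow))
    have h2 := h.trans this
    have : n ≤ n - 1 := by exact_mod_cast h2
    omega

/-- The length as a natural number, meaningful for objects of finite length. -/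
noncomputable def len (X : C) : ℕ := (objLength X).toNat

lemma hasChain_iff_le_len {X : C} (hX : objLength X ≠ ⊤) (n : ℕ) : HasChain n X ↔ n ≤ len X := by
  rw [hasChain_iff_le_objLength, ← ENat.natCast_toNat hX, Nat.cast_le]
  rfl

variable [Abelian C]

/-- A chain in the quotient is pulled back along `S.g`; properness survives because `S.g` is epi,
and the pulled-back chain ends in the given chain of the subobject. -/
lemma HasChain.add {S : ShortComplex C} (hS : S.ShortExact) {m n : ℕ} (h₁ : HasChain m S.X₁)
    (h₃ : HasChain n S.X₃) : HasChain (m + n) S.X₂ := by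
  induction n generalizing S with
  | zero =>
    have := hS.mono_f
    exact h₁.of_mono S.f
  | succ n ih =>
    obtain ⟨B, i, hi, hi', hB⟩ := h₃
    have := hS.mono_f
    have := hS.epi_g
    let X' := pullback S.g i
    let a : S.X₁ ⟶ X' := pullback.lift S.f 0 (by simp)
    have ha : a ≫ pullback.fst S.g i = S.f := pullback.lift_fst _ _ _
    let S' : ShortComplex C := ShortComplex.mk a (pullback.snd S.g i) (pullback.lift_snd _ _ _)
    have hmono : Mono a := by
      have : Mono (a ≫ pullback.fst S.g i) := by rw [ha]; infer_instance
      exact mono_of_mono a (pullback.fst S.g i)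
    have hepi : Epi (pullback.snd S.g i) := inferInstance
    have hS' : S'.ShortExact := by
      have : Mono S'.f := hmono
      have : Epi S'.g := hepi
      refine ShortComplex.ShortExact.mk (S := S') (S'.exact_of_f_is_kernel
        (KernelFork.IsLimit.ofι' _ _ fun {A} k hk => ?_))
      have hk' : (k ≫ pullback.fst S.g i) ≫ S.g = 0 := by
        rw [Category.assoc, pullback.condition, ← Category.assoc]
        change (k ≫ S'.g) ≫ i = 0
        rw [hk, zero_comp]
      refine ⟨hS.fIsKernel.lift (KernelFork.ofι _ hk'), ?_⟩
      have hl : hS.fIsKernel.lift (KernelFork.ofι _ hk') ≫ S.f = k ≫ pullback.fst S.g i :=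
        hS.fIsKernel.fac (KernelFork.ofι _ hk') WalkingParallelPair.zero
      apply pullback.hom_ext
      · rw [Category.assoc]
        change _ ≫ a ≫ _ = _
        rw [ha, hl]
      · rw [Category.assoc]
        change _ ≫ a ≫ _ = k ≫ S'.g
        rw [hk, pullback.lift_snd, comp_zero]
    refine ⟨X', pullback.fst S.g i, inferInstance, fun hiso => hi' ?_, ih hS' h₁ hB⟩
    have : Epi (pullback.snd S.g i ≫ i) := by
      rw [← pullback.condition]; infer_instance
    have : Epi i := epi_of_epi (pullback.snd S.g i) i
    exact isIso_of_mono_of_epi i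

/-- By the five lemma a proper subobject of the middle term is proper either in its intersection
with `S.X₁` or in its image in `S.X₃`, so each step of the chain is charged to one end. -/
lemma HasChain.exists_add {S : ShortComplex C} (hS : S.ShortExact) {r : ℕ}
    (h : HasChain r S.X₂) : ∃ m n, m + n = r ∧ HasChain m S.X₁ ∧ HasChain n S.X₃ := by
  induction r generalizing S with
  | zero => exact ⟨0, 0, rfl, trivial, trivial⟩
  | succ r ih =>
    obtain ⟨X', i, hi, hi', hX'⟩ := h
    have := hS.mono_f
    have := hS.epi_g
    let q : X' ⟶ image (i ≫ S.g) := factorThruImage (i ≫ S.g)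
    let ι : image (i ≫ S.g) ⟶ S.X₃ := image.ι (i ≫ S.g)
    have hq : q ≫ ι = i ≫ S.g := image.fac _
    let S' : ShortComplex C := ShortComplex.mk (kernel.ι q) q (kernel.condition q)
    have hS' : S'.ShortExact := by
      have : Mono S'.f := inferInstanceAs (Mono (kernel.ι q))
      have : Epi S'.g := inferInstanceAs (Epi (factorThruImage (i ≫ S.g)))
      exact ShortComplex.ShortExact.mk (S := S') (ShortComplex.exact_kernel q)
    have hk : (kernel.ι q ≫ i) ≫ S.g = 0 := by
      rw [Category.assoc]
      refine (congrArg (kernel.ι q ≫ ·) hq.symm).trans ?_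
      simp
    let j : kernel q ⟶ S.X₁ := hS.fIsKernel.lift (KernelFork.ofι _ hk)
    have hj : j ≫ S.f = kernel.ι q ≫ i :=
      hS.fIsKernel.fac (KernelFork.ofι _ hk) WalkingParallelPair.zero
    have hjm : Mono j := by
      have : Mono (j ≫ S.f) := by rw [hj]; infer_instance
      exact mono_of_mono j S.f
    have hιm : Mono ι := inferInstanceAs (Mono (image.ι _))
    obtain ⟨m, n, hmn, hm, hn⟩ := ih hS' hX'
    by_cases hjiso : IsIso j
    · refine ⟨m, n + 1, by omega, hm.of_mono j, ⟨_, ι, hιm, fun hιiso => hi' ?_, hn⟩⟩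
      let φ : S' ⟶ S := ⟨j, i, ι, hj, hq.symm⟩
      exact ShortComplex.isIso₂_of_shortExact_of_isIso₁₃ φ hS' hS
    · exact ⟨m + 1, n, by omega, ⟨_, j, hjm, hjiso, hm⟩, hn.of_mono ι⟩

lemma len_add {S : ShortComplex C} (hS : S.ShortExact) (h₁ : objLength S.X₁ ≠ ⊤)
    (h₂ : objLength S.X₂ ≠ ⊤) (h₃ : objLength S.X₃ ≠ ⊤) :
    len S.X₂ = len S.X₁ + len S.X₃ := by
  apply le_antisymm
  · obtain ⟨m, n, hmn, hm, hn⟩ :=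
      HasChain.exists_add hS ((hasChain_iff_le_len h₂ _).2 le_rfl)
    rw [hasChain_iff_le_len h₁] at hm
    rw [hasChain_iff_le_len h₃] at hn
    omega
  · exact (hasChain_iff_le_len h₂ _).1 (HasChain.add hS ((hasChain_iff_le_len h₁ _).2 le_rfl)
      ((hasChain_iff_le_len h₃ _).2 le_rfl))

lemma hasChain_one_iff (X : C) : HasChain 1 X ↔ ¬ IsZero X := by
  constructor
  · rintro ⟨A, i, hi, hi', -⟩ h
    refine hi' ⟨0, ?_, h.eq_of_tgt _ _⟩
    rw [← cancel_mono i]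
    exact h.eq_of_tgt _ _
  · intro h
    refine ⟨0, 0, inferInstance, fun hiso => h ?_, trivial⟩
    exact (isZero_zero C).of_iso (asIso (0 : (0 : C) ⟶ X)).symm

lemma len_eq_zero_iff {X : C} (hX : objLength X ≠ ⊤) : len X = 0 ↔ IsZero X := by
  have h := hasChain_iff_le_len hX 1
  rw [hasChain_one_iff] at h
  rw [← not_iff_not, h]
  omega

end Length

/-! ### Exactness of the tensor product -/

section Exactness

variable {C : Type u} [Category.{v} C] [MonoidalCategory C] [RigidCategory C]

instance isLeftAdjoint_tensorLeft (A : C) : (tensorLeft A).IsLeftAdjoint :=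
  ⟨_, ⟨tensorLeftAdjunction (ᘁA) A⟩⟩

instance isRightAdjoint_tensorLeft (A : C) : (tensorLeft A).IsRightAdjoint :=
  ⟨_, ⟨tensorLeftAdjunction A (Aᘁ)⟩⟩

instance isLeftAdjoint_tensorRight (A : C) : (tensorRight A).IsLeftAdjoint :=
  ⟨_, ⟨tensorRightAdjunction A (Aᘁ)⟩⟩

instance isRightAdjoint_tensorRight (A : C) : (tensorRight A).IsRightAdjoint :=
  ⟨_, ⟨tensorRightAdjunction (ᘁA) A⟩⟩

instance mono_whiskerLeft (A : C) {X Y : C} (f : X ⟶ Y) [Mono f] : Mono (A ◁ f) :=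
  inferInstanceAs (Mono ((tensorLeft A).map f))

instance epi_whiskerLeft (A : C) {X Y : C} (f : X ⟶ Y) [Epi f] : Epi (A ◁ f) :=
  inferInstanceAs (Epi ((tensorLeft A).map f))

instance mono_whiskerRight (A : C) {X Y : C} (f : X ⟶ Y) [Mono f] : Mono (f ▷ A) :=
  inferInstanceAs (Mono ((tensorRight A).map f))

instance epi_whiskerRight (A : C) {X Y : C} (f : X ⟶ Y) [Epi f] : Epi (f ▷ A) :=
  inferInstanceAs (Epi ((tensorRight A).map f))

end Exactness

/-! ### Subobjects of the unit -/

section Unit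

/-- The zigzag identity makes `U` a retract of `U ⊗ (V ⊗ U)`. -/
lemma isZero_of_isZero_tensor_dual_tensor {C : Type u} [Category.{v} C] [Abelian C]
    [MonoidalCategory C] {U V : C} [ExactPairing U V]
    (h : IsZero (U ⊗ (V ⊗ U))) : IsZero U := by
  rw [IsZero.iff_id_eq_zero]
  have h1 := ExactPairing.evaluation_coevaluation U V
  have h2 : (λ_ U).inv ≫ ((λ_ U).hom ≫ (ρ_ U).inv) ≫ (ρ_ U).hom = 0 := by
    rw [← h1]
    simp only [Category.assoc]
    rw [h.eq_of_tgt ((α_ U V U).hom) 0]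
    simp
  simpa using h2

lemma isZero_of_epi {C : Type u} [Category.{v} C] [Abelian C] {X Y : C} (f : X ⟶ Y) [Epi f]
    (h : IsZero X) : IsZero Y := by
  rw [IsZero.iff_id_eq_zero, ← cancel_epi f]
  exact h.eq_of_src _ _

lemma isZero_of_mono {C : Type u} [Category.{v} C] [Abelian C] {X Y : C} (f : X ⟶ Y) [Mono f]
    (h : IsZero Y) : IsZero X := by
  rw [IsZero.iff_id_eq_zero, ← cancel_mono f]
  exact h.eq_of_tgt _ _

variable {C : Type u} [Category.{v} C] [Abelian C] [MonoidalCategory C] [MonoidalPreadditive C]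

lemma isZero_tensor_left (A : C) {Z : C} (hZ : IsZero Z) : IsZero (A ⊗ Z) :=
  (tensorLeft A).map_isZero hZ

lemma isZero_tensor_right (A : C) {Z : C} (hZ : IsZero Z) : IsZero (Z ⊗ A) :=
  (tensorRight A).map_isZero hZ

variable [RigidCategory C]

/-- The mate `𝟙 ⟶ Uᘁ` of a morphism `U ⟶ 𝟙`. -/
noncomputable def unitMate {U : C} (i : U ⟶ 𝟙_ C) : 𝟙_ C ⟶ Uᘁ :=
  η_ U (Uᘁ) ≫ i ▷ Uᘁ ≫ (λ_ _).hom

lemma eq_zero_of_coevaluation_comp {U T : C} (t : Uᘁ ⟶ T) (h : η_ U (Uᘁ) ≫ U ◁ t = 0) :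
    t = 0 := by
  have h1 : tensorLeftHomEquiv (𝟙_ C) U (Uᘁ) T ((ρ_ _).hom ≫ t) = η_ U (Uᘁ) ≫ U ◁ t := by
    simp [tensorLeftHomEquiv, ← unitors_equal]
  have h2 : tensorLeftHomEquiv (𝟙_ C) U (Uᘁ) T 0 = 0 := by
    simp [tensorLeftHomEquiv]
  rw [h, ← h2] at h1
  have h3 := (tensorLeftHomEquiv (𝟙_ C) U (Uᘁ) T).injective h1
  rwa [← cancel_epi (ρ_ _).hom, comp_zero]

/-- If `t` kills the mate, then the transpose of `t`, followed by the monomorphism `i ▷ T`, is zero;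
so the transpose is zero, and `t` with it. -/
instance epi_unitMate {U : C} (i : U ⟶ 𝟙_ C) [Mono i] : Epi (unitMate i) := by
  refine Preadditive.epi_of_cancel_zero _ fun {T} t ht => eq_zero_of_coevaluation_comp t ?_
  rw [← cancel_mono (i ▷ T), ← cancel_mono (λ_ T).hom]
  simp only [Category.assoc, zero_comp]
  rw [← ht, unitMate, whisker_exchange_assoc]
  simp

omit [Abelian C] [MonoidalPreadditive C] in
lemma unitMate_whiskerRight_evaluation {U : C} (i : U ⟶ 𝟙_ C) :
    unitMate i ▷ U ≫ ε_ U (Uᘁ) = (λ_ U).hom ≫ i := by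
  have h1 := ExactPairing.evaluation_coevaluation U (Uᘁ)
  calc unitMate i ▷ U ≫ ε_ U (Uᘁ)
      = (η_ U (Uᘁ) ▷ U ≫ (α_ U (Uᘁ) U).hom ≫ U ◁ ε_ U (Uᘁ)) ≫ i ▷ 𝟙_ C ≫ (λ_ _).hom := by
        simp only [Category.assoc, whisker_exchange_assoc, unitMate]
        simp
    _ = _ := by
        rw [h1]
        simp [unitors_equal]

/-- The unit has no nonzero ideal of square zero: tensoring the epimorphism `unitMate i` exhibits `U
⊗ (Uᘁ ⊗ U)`, of which `U` is a retract, as a quotient of `U ⊗ U`. -/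
lemma isZero_of_mono_unit {U : C} (i : U ⟶ 𝟙_ C) [Mono i] (h : IsZero (U ⊗ U)) : IsZero U := by
  refine isZero_of_isZero_tensor_dual_tensor (V := Uᘁ) (isZero_of_epi (U ◁ (unitMate i ▷ U)) ?_)
  exact h.of_iso (whiskerLeftIso U (λ_ U))

/-- Let K be the kernel. Composing with the evaluation shows that the monomorphism K ⊗ U → U ⊗ 𝟙
induced by `i` is zero, so K ⊗ U = 0. As K embeds in `U`, also K ⊗ K = 0, and the square-zero
criterion applies to K. -/
lemma isIso_whiskerLeft_unitMate {U : C} (i : U ⟶ 𝟙_ C) [Mono i] :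
    IsIso (U ◁ unitMate i) := by
  have : Mono (U ◁ unitMate i) := by
    let κ := kernel.ι (U ◁ unitMate i)
    have hκ : κ ≫ U ◁ unitMate i = 0 := kernel.condition _
    have h1 : κ ▷ U ≫ (ρ_ U).hom ▷ U ≫ U ◁ i = 0 := by
      have h2 : (κ ≫ U ◁ unitMate i) ▷ U ≫ (α_ _ _ _).hom ≫ U ◁ ε_ U (Uᘁ) = 0 := by
        rw [hκ]; simp
      rw [← h2]
      simp only [comp_whiskerRight, Category.assoc, associator_naturality_middle_assoc,
        ← whiskerLeft_comp, unitMate_whiskerRight_evaluation]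
      simp
    have h3 : IsZero (kernel (U ◁ unitMate i) ⊗ U) := by
      rw [IsZero.iff_id_eq_zero, ← cancel_mono (κ ▷ U ≫ (ρ_ U).hom ▷ U ≫ U ◁ i), h1]
      simp
    have h4 : IsZero (kernel (U ◁ unitMate i)) :=
      isZero_of_mono_unit (κ ≫ (ρ_ U).hom ≫ i)
        (isZero_of_mono (kernel (U ◁ unitMate i) ◁ (κ ≫ (ρ_ U).hom)) h3)
    exact Preadditive.mono_of_kernel_zero (h4.eq_of_src _ _)
  exact isIso_of_mono_of_epi _

end Unit

/-! ### Simplicity of the unit and absence of zero divisors -/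

section TensorCategory

variable {k : Type w} [Field k] {C : Type u} [Category.{v} C] [Abelian C]
    [Linear k C] [MonoidalCategory C] [MonoidalPreadditive C] [MonoidalLinear k C]
    [RigidCategory C]

include k in
-- The isomorphism U ≅ U ⊗ Uᘁ turns the coevaluation into a nonzero `s : 𝟙 ⟶ U`. Then `s ≫ i` is a
-- nonzero scalar because `i` is mono and End(𝟙) = k, and a rescaling of `s` splits `i`.
lemma simple_unit (h : IsTensorCategory k C) : Simple (𝟙_ C) where
  mono_isIso_iff_nonzero {U} i _ := by
    constructor
    · rintro hi rfl
      have h1 : 𝟙 (𝟙_ C) = 0 := by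
        rw [← IsIso.inv_hom_id (0 : U ⟶ 𝟙_ C), comp_zero]
      have : (1 : k) = 0 := h.bijective_smul_id.1 (by simp [h1])
      exact one_ne_zero this
    · intro hi
      have := isIso_whiskerLeft_unitMate i
      let s : 𝟙_ C ⟶ U := η_ U (Uᘁ) ≫ inv (U ◁ unitMate i) ≫ (ρ_ U).hom
      have hs : s ≠ 0 := by
        intro hs
        have h1 : η_ U (Uᘁ) = 0 := by
          have : η_ U (Uᘁ) = s ≫ (ρ_ U).inv ≫ U ◁ unitMate i := by simp [s]
          rw [this, hs, zero_comp]
        have h2 := ExactPairing.evaluation_coevaluation U (Uᘁ)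
        rw [h1] at h2
        apply hi
        have h3 : 𝟙 U = 0 := by
          rw [← cancel_epi (λ_ U).hom, ← cancel_mono (ρ_ U).inv]
          simpa using h2.symm
        rw [← Category.id_comp i, h3, zero_comp]
      obtain ⟨a, ha⟩ := h.bijective_smul_id.2 (s ≫ i)
      have ha' : a • 𝟙 (𝟙_ C) = s ≫ i := ha
      have ha0 : a ≠ 0 := by
        rintro rfl
        rw [zero_smul] at ha'
        exact hs (by rw [← cancel_mono i, ← ha', zero_comp])
      have : IsSplitEpi i := ⟨⟨⟨a⁻¹ • s, by
        rw [Linear.smul_comp, ← ha', smul_smul, inv_mul_cancel₀ ha0, one_smul]⟩⟩⟩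
      exact isIso_of_mono_of_isSplitEpi i

/-- If the evaluation of `P` is zero, so is `P` by the zigzag identity. Otherwise it is epi onto the
simple unit, and `Q` is a quotient of Pᘁ ⊗ (P ⊗ Q). -/
lemma isZero_or_isZero_of_isZero_tensor [Simple (𝟙_ C)] {P Q : C} (h : IsZero (P ⊗ Q)) :
    IsZero P ∨ IsZero Q := by
  by_cases hε : ε_ P (Pᘁ) = 0
  · left
    have h2 := ExactPairing.evaluation_coevaluation P (Pᘁ)
    rw [hε] at h2
    rw [IsZero.iff_id_eq_zero, ← cancel_epi (λ_ P).hom, ← cancel_mono (ρ_ P).inv]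
    simpa using h2.symm
  · right
    have : Epi (ε_ P (Pᘁ)) := epi_of_nonzero_to_simple hε
    refine isZero_of_epi (ε_ P (Pᘁ) ▷ Q ≫ (λ_ Q).hom) ?_
    exact (isZero_tensor_left (Pᘁ) h).of_iso (α_ _ _ _)

end TensorCategory

/-! ### Surjectivity of transition maps for a chain of adjoint functors -/

section AdjointChain

set_option linter.unusedSectionVars false

variable {D : Type u} [Category.{v} D] [Abelian D] (L : ℕ → D ⥤ D) (adj : ∀ i, L (i + 1) ⊣ L i)

/-- Two successive objects of the continuant sequence attached to a chain of adjoint functors. -/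
structure ContinuantStage (n : ℕ) where
  prev : D
  next : D
  map : (L (n + 1)).obj next ⟶ prev

variable {L}

/-- The continuant sequence attached to a chain of adjoint functors: each object is the kernel of
the transpose of the inclusion of its predecessor. -/
noncomputable def continuantStage (s : ContinuantStage L 0) : (n : ℕ) → ContinuantStage L n
  | 0 => s
  | n + 1 =>
    { prev := (continuantStage s n).next
      next := kernel (continuantStage s n).map
      map := ((adj (n + 1)).homEquiv _ _).symm (kernel.ι (continuantStage s n).map) }

/-- A bifunctor `T` (a tensor product with unit `I`) commuting with a chain of adjoint functors in
its first variable. -/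
structure ChainTensor (adj : ∀ i, L (i + 1) ⊣ L i) (I : D) where
  T : D ⥤ D ⥤ D
  unitIso : T.obj I ≅ 𝟭 D
  assoc : ∀ i, T ⋙ (Functor.whiskeringRight D D D).obj (L i) ≅ L i ⋙ T
  assoc_unit : ∀ (i : ℕ) (P W : D),
    (adj i).unit.app ((T.obj P).obj W) ≫ (L i).map (((assoc (i + 1)).hom.app P).app W) ≫
      ((assoc i).hom.app ((L (i + 1)).obj P)).app W = (T.map ((adj i).unit.app P)).app W
  preservesFiniteColimits : ∀ W, PreservesFiniteColimits (T.flip.obj W)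
  preservesZeroMorphisms : ∀ P, (T.obj P).PreservesZeroMorphisms
  isZero_or : ∀ P W, IsZero ((T.obj P).obj W) → IsZero P ∨ IsZero W

namespace ChainTensor

variable {adj} {I : D} (τ : ChainTensor adj I)

/-- The associativity isomorphism of a chain tensor. -/
def a (i : ℕ) (P W : D) : (L i).obj ((τ.T.obj P).obj W) ≅ (τ.T.obj ((L i).obj P)).obj W :=
  ((τ.assoc i).app P).app W

lemma a_natural (i : ℕ) {P P' : D} (h : P ⟶ P') (W : D) :
    (L i).map ((τ.T.map h).app W) ≫ (τ.a i P' W).hom =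
      (τ.a i P W).hom ≫ (τ.T.map ((L i).map h)).app W :=
  congrArg (fun t => t.app W) ((τ.assoc i).hom.naturality h)

lemma a_natural_right (i : ℕ) (P : D) {W W' : D} (g : W ⟶ W') :
    (L i).map ((τ.T.obj P).map g) ≫ (τ.a i P W').hom =
      (τ.a i P W).hom ≫ (τ.T.obj ((L i).obj P)).map g :=
  ((τ.assoc i).hom.app P).naturality g

lemma a_natural_right_assoc (i : ℕ) (P : D) {W W' Z : D} (g : W ⟶ W')
    (z : (τ.T.obj ((L i).obj P)).obj W' ⟶ Z) :
    (L i).map ((τ.T.obj P).map g) ≫ (τ.a i P W').hom ≫ z =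
      (τ.a i P W).hom ≫ (τ.T.obj ((L i).obj P)).map g ≫ z := by
  rw [← Category.assoc, a_natural_right, Category.assoc]

/-- `assoc_unit` says that the associativity isomorphisms at `i` and `i + 1` are mates, so
transposition commutes with tensoring by `W`. -/
lemma mate (i : ℕ) {P P' : D} (h : (L (i + 1)).obj P ⟶ P') (W : D) :
    (adj i).homEquiv _ _ ((τ.a (i + 1) P W).hom ≫ (τ.T.map h).app W) ≫ (τ.a i P' W).hom =
      (τ.T.map ((adj i).homEquiv _ _ h)).app W := by
  have h1 := τ.assoc_unit i P W
  change _ ≫ (L i).map (τ.a (i + 1) P W).hom ≫ (τ.a i _ W).hom = _ at h1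
  simp only [Adjunction.homEquiv_unit, Functor.map_comp, Category.assoc, NatTrans.comp_app]
  rw [← h1, τ.a_natural]
  simp

lemma isZero_obj {P : D} (hP : IsZero P) (W : D) : IsZero ((τ.T.obj P).obj W) := by
  have := τ.preservesFiniteColimits W
  have h : (τ.T.flip.obj W).PreservesZeroMorphisms := inferInstance
  exact (τ.T.flip.obj W).map_isZero hP

lemma epi_map_app {P P' : D} (h : P ⟶ P') [Epi h] (W : D) : Epi ((τ.T.map h).app W) := by
  have := τ.preservesFiniteColimits W
  exact inferInstanceAs (Epi ((τ.T.flip.obj W).map h))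

lemma exists_desc {P P' : D} (h : P ⟶ P') (W : D) {Z : D} (t : (τ.T.obj P').obj W ⟶ Z)
    (ht : (τ.T.map h).app W ≫ t = 0) :
    ∃ t' : (τ.T.obj (cokernel h)).obj W ⟶ Z, (τ.T.map (cokernel.π h)).app W ≫ t' = t := by
  have := τ.preservesFiniteColimits W
  have hc := isColimitOfHasCokernelOfPreservesColimit (τ.T.flip.obj W) h
  exact ⟨hc.desc (CokernelCofork.ofπ t ht), hc.fac _ WalkingParallelPair.one⟩

variable {m : ℕ} {e e₁ e₀ Q : D}

/-- Compatible maps `P ⊗ e → e₁`, `P' ⊗ e → e₀`, `e₁ → P ⊗ Q` and `e₀ → P' ⊗ Q` for successive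
terms `e₁`, `e₀` of a continuant sequence and a morphism `π : e ⟶ Q`. -/
structure Factorization (f : (L (m + 1)).obj e₁ ⟶ e₀) (π : e ⟶ Q) where
  P : D
  P' : D
  h : (L (m + 1)).obj P ⟶ P'
  ψ : (τ.T.obj P).obj e ⟶ e₁
  ψ' : (τ.T.obj P').obj e ⟶ e₀
  θ : e₁ ⟶ (τ.T.obj P).obj Q
  θ' : e₀ ⟶ (τ.T.obj P').obj Q
  epi_θ' : Epi θ'
  comm_ψ : (L (m + 1)).map ψ ≫ f = (τ.a (m + 1) P e).hom ≫ (τ.T.map h).app e ≫ ψ'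
  comm_θ : f ≫ θ' = (L (m + 1)).map θ ≫ (τ.a (m + 1) P Q).hom ≫ (τ.T.map h).app Q
  fac' : ψ' ≫ θ' = (τ.T.obj P').map π
  nondegenerate : ∀ {J : D} (g : J ⟶ e), (τ.T.obj P').map g ≫ ψ' = 0 → g = 0

namespace Factorization

variable {τ} {f : (L (m + 1)).obj e₁ ⟶ e₀} {π : e ⟶ Q}

/-- The initial factorization of a quotient of the last term of a continuant sequence. -/
noncomputable def base (τ : ChainTensor adj I) {π : e₀ ⟶ Q} [Epi π] (hπ : f ≫ π = 0) :
    τ.Factorization f π where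
  P := 0
  P' := I
  h := 0
  ψ := 0
  ψ' := τ.unitIso.hom.app _
  θ := 0
  θ' := π ≫ τ.unitIso.inv.app Q
  epi_θ' := epi_comp _ _
  comm_ψ := by
    have : (L (m + 1)).IsLeftAdjoint := ⟨_, ⟨adj m⟩⟩
    have := Functor.preservesZeroMorphisms_of_isLeftAdjoint (L (m + 1))
    exact ((L (m + 1)).map_isZero (τ.isZero_obj (isZero_zero D) _)).eq_of_src _ _
  comm_θ := by
    have : (L (m + 1)).IsLeftAdjoint := ⟨_, ⟨adj m⟩⟩
    have := Functor.preservesZeroMorphisms_of_isLeftAdjoint (L (m + 1))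
    rw [← Category.assoc, hπ, zero_comp, Functor.map_zero, zero_comp]
  fac' := by
    have h := τ.unitIso.hom.naturality π
    simp only [Functor.id_map] at h
    rw [← Category.assoc, ← h, Category.assoc, Iso.hom_inv_id_app, Category.comp_id]
  nondegenerate {J} g hg := by
    rw [τ.unitIso.hom.naturality g] at hg
    simpa using hg

/-- One step of the descent towards the unit. The coefficient objects themselves follow a continuant
recursion, with cokernels in place of kernels: the new `P'` is the cokernel of the transpose of
`F.h`. The new `ψ'` descends to this cokernel by right exactness, and the new `θ'` exists because
the epi `f` is the cokernel of its kernel. -/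
lemma step (F : τ.Factorization (((adj (m + 1)).homEquiv _ _).symm (kernel.ι f)) π) (hepi : Epi f)
    (hmono : Mono ((adj m).homEquiv _ _ f)) : Nonempty (τ.Factorization f π) := by
  let hb := (adj (m + 1)).homEquiv _ _ F.h
  have : Epi F.θ' := F.epi_θ'
  have hLadj : (L (m + 1)).IsLeftAdjoint := ⟨_, ⟨adj m⟩⟩
  have hψ' : (τ.T.map hb).app e ≫ (τ.a (m + 1) F.P' e).inv ≫ (L (m + 1)).map F.ψ' =
      F.ψ ≫ kernel.ι f := by
    have h1 := congrArg ((adj (m + 1)).homEquiv _ _) F.comm_ψ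
    rw [Adjunction.homEquiv_naturality_left, Equiv.apply_symm_apply] at h1
    rw [h1, ← τ.mate (m + 1) F.h e, ← Category.assoc _ _ F.ψ',
      Adjunction.homEquiv_naturality_right _ _ F.ψ']
    simp
  have hθ' : kernel.ι f ≫ (L (m + 1)).map F.θ' ≫ (τ.a (m + 1) F.P' Q).hom =
      F.θ ≫ (τ.T.map hb).app Q := by
    have h1 := congrArg ((adj (m + 1)).homEquiv _ _) F.comm_θ
    rw [Adjunction.homEquiv_naturality_right, Adjunction.homEquiv_naturality_left,
      Equiv.apply_symm_apply] at h1
    rw [← τ.mate (m + 1) F.h Q, ← Category.assoc F.θ, ← h1, ← Category.assoc]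
  -- By `hψ'` the restriction along `hb` factors through the kernel of `f`, so it is killed by `f`.
  obtain ⟨ψ'', hψ''⟩ := τ.exists_desc hb e ((τ.a (m + 1) F.P' e).inv ≫ (L (m + 1)).map F.ψ' ≫ f)
    (by
      have h3 := congrArg (· ≫ f) hψ'
      simp only [Category.assoc, kernel.condition, comp_zero] at h3
      exact h3)
  have hf : kernel.ι f ≫ ((L (m + 1)).map F.θ' ≫ (τ.a (m + 1) F.P' Q).hom ≫
      (τ.T.map (cokernel.π hb)).app Q) = 0 := by
    have h3 := congrArg (· ≫ (τ.T.map (cokernel.π hb)).app Q) hθ'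
    simp only [Category.assoc] at h3
    rw [h3, ← NatTrans.comp_app, ← Functor.map_comp, cokernel.condition]
    refine (congrArg _ ?_).trans comp_zero
    have := τ.preservesFiniteColimits Q
    exact (τ.T.flip.obj Q).map_zero _ _
  let hc := Abelian.epiIsCokernelOfKernel (KernelFork.ofι (kernel.ι f) (kernel.condition f))
    (kernelIsKernel f)
  let θ'' : e₀ ⟶ (τ.T.obj (cokernel hb)).obj Q := hc.desc (CokernelCofork.ofπ _ hf)
  have hθ'' : f ≫ θ'' = (L (m + 1)).map F.θ' ≫ (τ.a (m + 1) F.P' Q).hom ≫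
      (τ.T.map (cokernel.π hb)).app Q :=
    hc.fac (CokernelCofork.ofπ _ hf) WalkingParallelPair.one
  have hepiT := τ.epi_map_app (cokernel.π hb)
  refine ⟨⟨F.P', cokernel hb, cokernel.π hb, F.ψ', ψ'', F.θ', θ'', ?_, ?_, hθ'', ?_, ?_⟩⟩
  · have h4 : Epi (f ≫ θ'') := by
      rw [hθ'']
      have := hepiT Q
      have h5 : Epi ((L (m + 1)).map F.θ') := inferInstance
      exact epi_comp' h5 (epi_comp' inferInstance this)
    exact epi_of_epi f θ''
  · rw [hψ'']
    simp
  · have h5 := hepiT e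
    rw [← cancel_epi ((τ.T.map (cokernel.π hb)).app e), ← Category.assoc, hψ'']
    simp only [Category.assoc]
    rw [hθ'', ← Functor.map_comp_assoc, F.fac', Iso.inv_comp_eq, ← NatTrans.naturality,
      τ.a_natural_right_assoc]
  · intro J g hg
    apply F.nondegenerate
    have h6 : (L (m + 1)).map ((τ.T.obj F.P').map g ≫ F.ψ') ≫ f = 0 := by
      have h7 : (τ.T.map (cokernel.π hb)).app J ≫ (τ.T.obj (cokernel hb)).map g ≫ ψ'' = 0 := by
        rw [hg, comp_zero]
      rw [← NatTrans.naturality_assoc, hψ''] at h7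
      have h8 := congrArg ((τ.a (m + 1) F.P' J).hom ≫ ·) h7
      simp only [comp_zero] at h8
      rw [← τ.a_natural_right_assoc] at h8
      simpa using h8
    -- Transposing moves `L (m + 1)` off the pairing; the transpose of `f` is mono and can be
    -- cancelled, which leaves the nondegeneracy of `F`.
    have h9 := congrArg ((adj m).homEquiv _ _) h6
    erw [Adjunction.homEquiv_naturality_left] at h9
    rw [← cancel_mono ((adj m).homEquiv _ _ f), zero_comp]
    refine h9.trans ?_
    have : (L m).IsRightAdjoint := ⟨_, ⟨adj m⟩⟩
    have := Functor.preservesZeroMorphisms_of_isRightAdjoint (L m)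
    rw [Adjunction.homEquiv_unit, Functor.map_zero, comp_zero]

end Factorization

variable (s : ContinuantStage L 0) (n : ℕ)

include τ in
/-- As long as a continuant sequence has surjective transition maps, the next transition map is
surjective or the next continuant vanishes. -/
theorem epi_map_of_not_isZero (hI : Simple s.prev)
    (hs : Mono ((adj 0).homEquiv _ _ s.map))
    (hepi : ∀ m < n, Epi (continuantStage adj s m).map)
    (hn : ¬ IsZero (continuantStage adj s n).next) : Epi (continuantStage adj s n).map := by
  let f := (continuantStage adj s n).map
  have hmono : ∀ m, Mono ((adj m).homEquiv _ _ (continuantStage adj s m).map) := by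
    intro m
    cases m with
    | zero => exact hs
    | succ m =>
      have : (adj (m + 1)).homEquiv _ _ (continuantStage adj s (m + 1)).map =
        kernel.ι (continuantStage adj s m).map := Equiv.apply_symm_apply _ _
      rw [this]
      exact equalizer.ι_mono
  have hπ : f ≫ cokernel.π f = 0 := cokernel.condition f
  -- Descent from level `n`, where the pairing is the unit isomorphism, to level 0, where the target
  -- is the simple object `s.prev`.
  have key : ∀ j ≤ n,
      Nonempty (τ.Factorization (continuantStage adj s (n - j)).map (cokernel.π f)) := by
    intro j hj
    induction j with
    | zero => exact ⟨Factorization.base τ hπ⟩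
    | succ j ih =>
      obtain ⟨F⟩ := ih (by omega)
      obtain ⟨i, hi⟩ : ∃ i, n - j = i + 1 := ⟨n - j - 1, by omega⟩
      rw [hi] at F
      have := Factorization.step F (hepi i (by omega)) (hmono i)
      rwa [show n - (j + 1) = i by omega]
  obtain ⟨F⟩ := key n le_rfl
  rw [Nat.sub_self] at F
  have : Epi F.θ' := F.epi_θ'
  have hQ : IsZero (cokernel f) := by
    by_cases h0 : F.θ' = 0
    · have hz : IsZero ((τ.T.obj F.P').obj (cokernel f)) := by
        rw [IsZero.iff_id_eq_zero, ← cancel_epi F.θ', h0, zero_comp, zero_comp]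
      rcases τ.isZero_or _ _ hz with h | h
      -- With P' = 0 nondegeneracy kills the identity, so the source of the cokernel projection is
      -- already zero.
      · have h1 := F.nondegenerate (𝟙 _) ((τ.isZero_obj h _).eq_of_src _ _)
        exact isZero_of_epi (cokernel.π f) ((IsZero.iff_id_eq_zero _).2 h1)
      · exact h
    · exfalso
      have : Simple (continuantStage adj s 0).prev := hI
      have : Mono F.θ' := Preadditive.mono_of_kernel_zero
        (kernel_zero_of_nonzero_from_simple h0)
      have h1 : kernel.ι (cokernel.π f) = 0 := by
        apply F.nondegenerate
        rw [← cancel_mono F.θ', Category.assoc, F.fac', ← Functor.map_comp, kernel.condition,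
          zero_comp]
        have := τ.preservesZeroMorphisms F.P'
        exact Functor.map_zero _ _ _
      have h2 : f = 0 := by
        have : Mono (cokernel.π f) := Preadditive.mono_of_kernel_zero h1
        rw [← cancel_mono (cokernel.π f), hπ, zero_comp]
      have h3 := hmono n
      -- With `f = 0` its transpose is both zero and mono, so the next continuant vanishes.
      apply hn
      rw [IsZero.iff_id_eq_zero,
        ← cancel_mono ((adj n).homEquiv _ _ (continuantStage adj s n).map), zero_comp,
        Category.id_comp]
      change (adj n).homEquiv _ _ f = 0
      have : (L n).IsRightAdjoint := ⟨_, ⟨adj n⟩⟩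
      have := Functor.preservesZeroMorphisms_of_isRightAdjoint (L n)
      rw [h2, Adjunction.homEquiv_unit, Functor.map_zero, comp_zero]
  exact Preadditive.epi_of_cokernel_zero (hQ.eq_of_tgt _ _)

end ChainTensor

end AdjointChain

instance simple_op {C : Type u} [Category.{v} C] [Abelian C] (S : C) [Simple S] :
    Simple (op S) where
  mono_isIso_iff_nonzero {Y} f _ := by
    constructor
    · rintro _ rfl
      have h : 𝟙 (op S) = 0 := by
        rw [← IsIso.inv_hom_id (0 : Y ⟶ op S), comp_zero]
      exact id_nonzero S (Quiver.Hom.op_inj h)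
    · intro hf
      have h0 : f.unop ≠ 0 := fun h => hf (Quiver.Hom.unop_inj h)
      have : Mono f.unop := Preadditive.mono_of_kernel_zero (kernel_zero_of_nonzero_from_simple h0)
      have : IsIso f.unop := isIso_of_mono_of_epi f.unop
      exact inferInstanceAs (IsIso f.unop.op)

/-! ### The continuant objects of X and their duals -/

section Instances

set_option linter.unusedSectionVars false

variable {C : Type u} [Category.{v} C] [Abelian C] [MonoidalCategory C] [MonoidalPreadditive C]
  [RigidCategory C]

/-- The chain of adjoint functors `X^{(i)} ⊗ -`. -/
abbrev leftChain (X : C) (i : ℕ) : C ⥤ C := tensorLeft (iterDual X i)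

/-- The functor `X^{(i+1)} ⊗ -` is left adjoint to `X^{(i)} ⊗ -`. -/
noncomputable abbrev leftChainAdj (X : C) (i : ℕ) : leftChain X (i + 1) ⊣ leftChain X i :=
  tensorLeftAdjunction (iterDual X i) (iterDual X (i + 1))

/-- The chain of adjoint functors on the opposite category given by `- ⊗ X^{(i)}`. -/
abbrev rightChain (X : C) (i : ℕ) : Cᵒᵖ ⥤ Cᵒᵖ := (tensorRight (iterDual X i)).op

/-- On the opposite category `- ⊗ X^{(i+1)}` is left adjoint to `- ⊗ X^{(i)}`. -/
noncomputable abbrev rightChainAdj (X : C) (i : ℕ) : rightChain X (i + 1) ⊣ rightChain X i :=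
  (tensorRightAdjunction (iterDual X i) (iterDual X (i + 1))).op

/-- The start of the sequence of continuants: `𝟙`, `X` and the evaluation. -/
noncomputable def lowerStart (X : C) : ContinuantStage (leftChain X) 0 where
  prev := 𝟙_ C
  next := X
  map := ε_ X (Xᘁ)

/-- The start of the sequence of dual continuants: `𝟙`, `X` and the coevaluation. -/
noncomputable def upperStart (X : C) : ContinuantStage (rightChain X) 0 where
  prev := op (𝟙_ C)
  next := op X
  map := (η_ X (Xᘁ)).op

/-- The tensor product of `C` commutes with the chain `X^{(i)} ⊗ -`. -/
noncomputable def leftChainTensor [Simple (𝟙_ C)] (X : C) :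
    ChainTensor (leftChainAdj X) (𝟙_ C) where
  T := curriedTensor C
  unitIso := NatIso.ofComponents (fun W => λ_ W)
  assoc i := NatIso.ofComponents (fun P => NatIso.ofComponents
    (fun W => (α_ (iterDual X i) P W).symm))
  assoc_unit i P W := by
    simp [tensorLeftAdjunction, tensorLeftHomEquiv]
  preservesFiniteColimits W :=
    inferInstanceAs (PreservesFiniteColimits (tensorRight W))
  preservesZeroMorphisms P :=
    inferInstanceAs ((tensorLeft P).PreservesZeroMorphisms)
  isZero_or P W h := isZero_or_isZero_of_isZero_tensor h

/-- The bifunctor `(P, W) ↦ W ⊗ P` on the opposite category. -/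
@[simps]
def opTensor (C : Type u) [Category.{v} C] [MonoidalCategory C] : Cᵒᵖ ⥤ Cᵒᵖ ⥤ Cᵒᵖ where
  obj P := (tensorRight P.unop).op
  map h := NatTrans.op ((curriedTensor C).flip.map h.unop)

/-- The tensor product of `Cᵒᵖ` commutes with the chain `- ⊗ X^{(i)}`. -/
noncomputable def rightChainTensor [Simple (𝟙_ C)] (X : C) :
    ChainTensor (rightChainAdj X) (op (𝟙_ C)) where
  T := opTensor C
  unitIso := NatIso.ofComponents (fun W => (ρ_ W.unop).symm.op)
    (fun f => Quiver.Hom.unop_inj (rightUnitor_inv_naturality f.unop).symm)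
  assoc i := NatIso.ofComponents (fun P => NatIso.ofComponents
    (fun W => (α_ W.unop P.unop (iterDual X i)).symm.op)
      (fun f => Quiver.Hom.unop_inj
        (associator_inv_naturality_left f.unop P.unop (iterDual X i)).symm))
      (fun f => by
        ext W
        exact Quiver.Hom.unop_inj
          (associator_inv_naturality_middle W.unop f.unop (iterDual X i)).symm)
  assoc_unit i P W := by
    apply Quiver.Hom.unop_inj
    change ((α_ W.unop (P.unop ⊗ iterDual X (i + 1)) (iterDual X i)).inv ≫
      (α_ W.unop P.unop (iterDual X (i + 1))).inv ▷ iterDual X i) ≫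
      (tensorRightAdjunction (iterDual X i) (iterDual X (i + 1))).counit.app (W.unop ⊗ P.unop) =
      W.unop ◁ (tensorRightAdjunction (iterDual X i) (iterDual X (i + 1))).counit.app P.unop
    simp [tensorRightAdjunction, tensorRightHomEquiv]
  preservesFiniteColimits W :=
    inferInstanceAs (PreservesFiniteColimits (tensorLeft W.unop).op)
  preservesZeroMorphisms P :=
    inferInstanceAs ((tensorRight P.unop).op.PreservesZeroMorphisms)
  isZero_or P W h :=
    (isZero_or_isZero_of_isZero_tensor (P := W.unop) (Q := P.unop) h.unop).symm.imp
      (fun h => h.op) (fun h => h.op)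

lemma mono_transpose_lowerStart (X : C) :
    Mono ((leftChainAdj X 0).homEquiv _ _ (lowerStart X).map) := by
  have h : (leftChainAdj X 0).homEquiv _ _ (lowerStart X).map = (ρ_ X).inv := by
    have := ExactPairing.evaluation_coevaluation X (Xᘁ)
    rw [show (leftChainAdj X 0).homEquiv _ _ (lowerStart X).map =
        tensorLeftHomEquiv X X (Xᘁ) (𝟙_ C) (ε_ X (Xᘁ)) from
      congrFun (congrArg DFunLike.coe
        (congrFun (congrFun (Adjunction.mkOfHomEquiv_homEquiv _) _) _)) _]
    change (λ_ X).inv ≫ (η_ X (Xᘁ) ▷ X ≫ (α_ X (Xᘁ) X).hom ≫ X ◁ ε_ X (Xᘁ)) = (ρ_ X).inv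
    rw [this]
    simp
  rw [h]
  exact inferInstanceAs (Mono (ρ_ X).inv)

lemma mono_transpose_upperStart (X : C) :
    Mono ((rightChainAdj X 0).homEquiv _ _ (upperStart X).map) := by
  have h : (rightChainAdj X 0).homEquiv _ _ (upperStart X).map = (λ_ X).hom.op := by
    apply Quiver.Hom.unop_inj
    rw [Adjunction.homEquiv_unit]
    change η_ X (Xᘁ) ▷ X ≫ (tensorRightAdjunction X (Xᘁ)).counit.app X = (λ_ X).hom
    have := ExactPairing.evaluation_coevaluation X (Xᘁ)
    simp [tensorRightAdjunction, tensorRightHomEquiv, reassoc_of% this]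
  rw [h]
  exact inferInstanceAs (Mono (λ_ X).hom.op)

/-- The sequence of continuants of `X`. -/
noncomputable abbrev lower (X : C) (n : ℕ) : ContinuantStage (leftChain X) n :=
  continuantStage (leftChainAdj X) (lowerStart X) n

/-- The sequence of dual continuants of `X`, in the opposite category. -/
noncomputable abbrev upper (X : C) (n : ℕ) : ContinuantStage (rightChain X) n :=
  continuantStage (rightChainAdj X) (upperStart X) n

/-- The `n`-th continuant of `X`. -/
noncomputable def lowerObj (X : C) (n : ℕ) : C := (lower X n).prev

/-- The `n`-th dual continuant of `X`. -/
noncomputable def upperObj (X : C) (n : ℕ) : C := (upper X n).prev.unop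

/-- The bound `n + 1` is the index of the continuant in the source of the map; strong induction
supplies the surjectivity of all earlier maps. -/
lemma epi_lower_map [Simple (𝟙_ C)] (X : C) (n : ℕ)
    (hn : ∀ m ≤ n + 1, ¬ IsZero (lowerObj X m)) : Epi (lower X n).map := by
  induction n using Nat.strong_induction_on with
  | _ n ih =>
    refine (leftChainTensor X).epi_map_of_not_isZero (lowerStart X) n
      (inferInstanceAs (Simple (𝟙_ C))) (mono_transpose_lowerStart X)
      (fun m hm => ih m hm fun j hj => hn j (by omega)) (hn (n + 1) le_rfl)

lemma epi_upper_map [Simple (𝟙_ C)] (X : C) (n : ℕ)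
    (hn : ∀ m ≤ n + 1, ¬ IsZero (upperObj X m)) : Epi (upper X n).map := by
  induction n using Nat.strong_induction_on with
  | _ n ih =>
    refine (rightChainTensor X).epi_map_of_not_isZero (upperStart X) n
      (inferInstanceAs (Simple (op (𝟙_ C)))) (mono_transpose_upperStart X)
      (fun m hm => ih m hm fun j hj => hn j (by omega)) (fun h => hn (n + 1) le_rfl h.unop)

end Instances

/-! ### Comparison of distinguished triangles -/

section Triangles

open Pretriangulated

variable {𝓣 : Type*} [Category 𝓣] [Preadditive 𝓣] [HasZeroObject 𝓣] [HasShift 𝓣 ℤ]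
  [∀ n : ℤ, (shiftFunctor 𝓣 n).Additive] [Pretriangulated 𝓣]

/-- The axioms provide some isomorphism `a'` completing `b` and `c`. The difference `a - a'` factors
through `T₂.obj₃⟦-1⟧`, so `hzero` gives a = a'; compatibility of `a` with the connecting maps need
not be checked. -/
lemma isIso_of_triangles₁ {T₁ T₂ : Triangle 𝓣} (h₁ : T₁ ∈ distTriang 𝓣) (h₂ : T₂ ∈ distTriang 𝓣)
    (a : T₁.obj₁ ⟶ T₂.obj₁) (b : T₁.obj₂ ⟶ T₂.obj₂) (c : T₁.obj₃ ⟶ T₂.obj₃) (hb : IsIso b)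
    (hc : IsIso c) (hab : a ≫ T₂.mor₁ = T₁.mor₁ ≫ b) (hbc : T₁.mor₂ ≫ c = b ≫ T₂.mor₂)
    (hzero : ∀ g : T₁.obj₁ ⟶ T₂.obj₃⟦(-1 : ℤ)⟧, g = 0) : IsIso a := by
  obtain ⟨a', ha', ha''⟩ := complete_distinguished_triangle_morphism₁ T₁ T₂ h₁ h₂ b c hbc
  let φ : T₁ ⟶ T₂ := { hom₁ := a', hom₂ := b, hom₃ := c, comm₁ := ha', comm₂ := hbc, comm₃ := ha'' }
  have hiso : IsIso a' := isIso₁_of_isIso₂₃ φ h₁ h₂ hb hc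
  have hz : (a - a') ≫ T₂.mor₁ = 0 := by
    rw [Preadditive.sub_comp, hab, ha', sub_self]
  obtain ⟨g, hg⟩ := Triangle.coyoneda_exact₂ _ (inv_rot_of_distTriang _ h₂) (a - a') hz
  rw [hzero g] at hg
  have : a = a' := sub_eq_zero.1 (hg.trans zero_comp)
  rwa [this]

lemma isIso_of_triangles₃ {T₁ T₂ : Triangle 𝓣} (h₁ : T₁ ∈ distTriang 𝓣) (h₂ : T₂ ∈ distTriang 𝓣)
    (a : T₁.obj₁ ⟶ T₂.obj₁) (b : T₁.obj₂ ⟶ T₂.obj₂) (c : T₁.obj₃ ⟶ T₂.obj₃) (ha : IsIso a)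
    (hb : IsIso b) (hab : T₁.mor₁ ≫ b = a ≫ T₂.mor₁) (hbc : T₁.mor₂ ≫ c = b ≫ T₂.mor₂)
    (hzero : ∀ g : T₁.obj₁⟦(1 : ℤ)⟧ ⟶ T₂.obj₃, g = 0) : IsIso c := by
  obtain ⟨c', hc', hc''⟩ := complete_distinguished_triangle_morphism T₁ T₂ h₁ h₂ a b hab
  let φ : T₁ ⟶ T₂ := { hom₁ := a, hom₂ := b, hom₃ := c', comm₁ := hab, comm₂ := hc', comm₃ := hc'' }
  have hiso : IsIso c' := isIso₃_of_isIso₁₂ φ h₁ h₂ ha hb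
  have hz : T₁.mor₂ ≫ (c - c') = 0 := by
    rw [Preadditive.comp_sub, hbc, hc', sub_self]
  obtain ⟨g, hg⟩ := Triangle.yoneda_exact₃ _ h₁ (c - c') hz
  rw [hzero g] at hg
  have : c = c' := sub_eq_zero.1 (hg.trans comp_zero)
  rwa [this]

lemma invRotate_mor₁_eq {D : Type*} [Category* D] [Preadditive D] [HasShift D ℤ]
    [∀ n : ℤ, Functor.Additive (shiftFunctor D n)] (T : Triangle D)
    (f : T.obj₃⟦(-1 : ℤ)⟧ ⟶ T.obj₁)
    (h : -f⟦(1 : ℤ)⟧' =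
      (shiftFunctorCompIsoId D (-1 : ℤ) 1 (by lia)).hom.app T.obj₃ ≫ T.mor₃) :
    T.invRotate.mor₁ = f := by
  have h1 : T.mor₃ = -(shiftFunctorCompIsoId D (-1 : ℤ) 1 (by lia)).inv.app T.obj₃ ≫
      f⟦(1 : ℤ)⟧' := by
    rw [← Preadditive.neg_comp, Preadditive.neg_comp, ← Preadditive.comp_neg, h]
    simp
  change -T.mor₃⟦(-1 : ℤ)⟧' ≫ (shiftFunctorCompIsoId D (1 : ℤ) (-1) (by lia)).hom.app T.obj₁ = f
  rw [h1, CategoryTheory.Functor.map_neg, Preadditive.neg_comp, neg_neg,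
    CategoryTheory.Functor.map_comp, Category.assoc]
  have h2 := (shiftFunctorCompIsoId D (1 : ℤ) (-1) (by lia)).hom.naturality f
  dsimp at h2
  rw [h2, shift_shiftFunctorCompIsoId_inv_app, Iso.inv_hom_id_app_assoc]

end Triangles

/-! ### Cones of maps modelled by objects in degree 0 -/

section Cones

open CochainComplex

variable {C : Type u} [Category.{v} C] [Abelian C]

/-- The functor placing an object in degree `0`. -/
noncomputable abbrev single₀ (C : Type u) [Category.{v} C] [Abelian C] :
    C ⥤ CochainComplex C ℤ :=
  HomologicalComplex.single C (ComplexShape.up ℤ) 0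

/-- Gives access to `mappingCocone.lift` for building chain maps with a prescribed composite with
`coconeMap`. -/
lemma coconeMap_eq_fst {K L : CochainComplex C ℤ} (F : K ⟶ L) :
    coconeMap F = mappingCocone.fst F := by
  refine invRotate_mor₁_eq (mappingCone.triangle F) (mappingCocone.fst F) ?_
  have h := (mappingCocone.rotateTriangleIso F).hom.comm₃
  exact ((Category.comp_id _).symm.trans
    (congrArg (_ ≫ ·) (CategoryTheory.Functor.map_id _ _).symm)).trans h

/-- As `f` is epi, its kernel sequence is short exact, and its triangle in the derived category is
compared with that of the cocone of `F`. -/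
lemma exists_quasiIso_cocone {K L : CochainComplex C ℤ} (F : K ⟶ L) {K₀ L₀ : C} (f : K₀ ⟶ L₀)
    [Epi f] (k : (single₀ C).obj K₀ ⟶ K) (l : (single₀ C).obj L₀ ⟶ L) (hk : QuasiIso k)
    (hl : QuasiIso l) (h : k ≫ F = (single₀ C).map f ≫ l) :
    ∃ b : (single₀ C).obj (kernel f) ⟶ coconeComplex F,
      QuasiIso b ∧ b ≫ coconeMap F = (single₀ C).map (kernel.ι f) ≫ k := by
  let := HasDerivedCategory.standard C
  let S : ShortComplex C := ShortComplex.mk (kernel.ι f) f (kernel.condition f)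
  have hS : S.ShortExact := by
    have : Mono S.f := inferInstanceAs (Mono (kernel.ι f))
    have : Epi S.g := inferInstanceAs (Epi f)
    exact ShortComplex.ShortExact.mk (S := S) (ShortComplex.exact_kernel f)
  have hSS := hS.map_of_exact (single₀ C)
  let b : (single₀ C).obj (kernel f) ⟶ mappingCocone F :=
    mappingCocone.lift F ((single₀ C).map (kernel.ι f) ≫ k) 0 (by
      rw [Category.assoc, h, ← Functor.map_comp_assoc, kernel.condition]
      simp)
  have hb : b ≫ mappingCocone.fst F = (single₀ C).map (kernel.ι f) ≫ k :=
    mappingCocone.lift_fst _ _ _ _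
  refine ⟨b, (DerivedCategory.isIso_Q_map_iff_quasiIso C b).1 ?_, (coconeMap_eq_fst F).symm ▸ hb⟩
  rw [← DerivedCategory.isIso_Q_map_iff_quasiIso] at hk hl
  refine isIso_of_triangles₁ (DerivedCategory.triangleOfSES_distinguished hSS)
    (DerivedCategory.mappingCocone_triangle_distinguished F)
    (DerivedCategory.Q.map b) (DerivedCategory.Q.map k) (DerivedCategory.Q.map l) hk hl ?_ ?_ ?_
  · exact (Functor.map_comp _ _ _).symm.trans
      ((congrArg DerivedCategory.Q.map hb).trans (Functor.map_comp _ _ _))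
  · exact (Functor.map_comp _ _ _).symm.trans
      ((congrArg DerivedCategory.Q.map h.symm).trans (Functor.map_comp _ _ _))
  -- The source lies in degrees ≤ 0 and `L⟦-1⟧` in degrees ≥ 1, so the t-structure leaves no nonzero
  -- map.
  · intro g
    have h1 : (DerivedCategory.Q.obj ((single₀ C).obj (kernel f))).IsLE 0 :=
      inferInstanceAs (((DerivedCategory.singleFunctor C 0).obj (kernel f)).IsLE 0)
    have h2 : (DerivedCategory.Q.obj ((single₀ C).obj L₀)).IsGE 0 :=
      inferInstanceAs (((DerivedCategory.singleFunctor C 0).obj L₀).IsGE 0)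
    have h3 : (DerivedCategory.Q.obj L).IsGE 0 :=
      DerivedCategory.TStructure.t.isGE_of_iso (asIso (DerivedCategory.Q.map l)) 0
    have h4 := DerivedCategory.TStructure.t.isGE_shift (DerivedCategory.Q.obj L) 0 (-1) 1
    exact DerivedCategory.TStructure.t.zero_of_isLE_of_isGE g 0 1 (by lia) h1 h4

/-- Dual comparison. An arbitrary cokernel `p` is allowed because the upper continuants supply one
as the `unop` of a kernel in the opposite category. -/
lemma exists_quasiIso_cone {K L : CochainComplex C ℤ} (F : K ⟶ L) {K₀ L₀ : C} (f : K₀ ⟶ L₀)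
    [Mono f] (k : K ⟶ (single₀ C).obj K₀) (l : L ⟶ (single₀ C).obj L₀) (hk : QuasiIso k)
    (hl : QuasiIso l) (h : F ≫ l = k ≫ (single₀ C).map f) {M₀ : C} (p : L₀ ⟶ M₀) (hfp : f ≫ p = 0)
    (hp : IsColimit (CokernelCofork.ofπ p hfp)) :
    ∃ b : mappingCone F ⟶ (single₀ C).obj M₀,
      QuasiIso b ∧ mappingCone.inr F ≫ b = l ≫ (single₀ C).map p := by
  let := HasDerivedCategory.standard C
  let S : ShortComplex C := ShortComplex.mk f p hfp
  have hS : S.ShortExact := by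
    have : Mono S.f := inferInstanceAs (Mono f)
    have : Epi S.g := Cofork.IsColimit.epi hp
    exact ShortComplex.ShortExact.mk (S := S) (S.exact_of_g_is_cokernel hp)
  have hSS := hS.map_of_exact (single₀ C)
  let b : mappingCone F ⟶ (single₀ C).obj M₀ :=
    mappingCone.desc F 0 (l ≫ (single₀ C).map p) (by
      rw [← Category.assoc, h, Category.assoc, ← Functor.map_comp, hfp]
      simp)
  have hb : mappingCone.inr F ≫ b = l ≫ (single₀ C).map p :=
    mappingCone.inr_desc _ _ _ _
  refine ⟨b, ?_, hb⟩
  rw [← DerivedCategory.isIso_Q_map_iff_quasiIso] at hk hl ⊢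
  refine isIso_of_triangles₃ (DerivedCategory.mappingCone_triangle_distinguished F)
    (DerivedCategory.triangleOfSES_distinguished hSS)
    (DerivedCategory.Q.map k) (DerivedCategory.Q.map l) (DerivedCategory.Q.map b) hk hl ?_ ?_ ?_
  · exact (Functor.map_comp _ _ _).symm.trans
      ((congrArg DerivedCategory.Q.map h).trans (Functor.map_comp _ _ _))
  · exact (Functor.map_comp _ _ _).symm.trans
      ((congrArg DerivedCategory.Q.map hb).trans (Functor.map_comp _ _ _))
  · intro g
    have h1 : (DerivedCategory.Q.obj ((single₀ C).obj K₀)).IsLE 0 :=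
      inferInstanceAs (((DerivedCategory.singleFunctor C 0).obj K₀).IsLE 0)
    have h2 : (DerivedCategory.Q.obj ((single₀ C).obj M₀)).IsGE 0 :=
      inferInstanceAs (((DerivedCategory.singleFunctor C 0).obj M₀).IsGE 0)
    have h3 : (DerivedCategory.Q.obj K).IsLE 0 :=
      DerivedCategory.TStructure.t.isLE_of_iso (asIso (DerivedCategory.Q.map k)).symm 0
    have h4 := DerivedCategory.TStructure.t.isLE_shift (DerivedCategory.Q.obj K) 0 1 (-1)
    exact DerivedCategory.TStructure.t.zero_of_isLE_of_isGE g (-1) 0 (by lia) h4 h2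

end Cones

lemma comp_inv_comp_hom_comp {D : Type*} [Category* D] {U V V' W : D} (p : U ⟶ V) (i : V' ≅ V)
    (q : V ⟶ W) : (p ≫ i.inv) ≫ i.hom ≫ q = p ≫ q := by
  simp

lemma comp_comp_inv_comp_hom_comp {D : Type*} [Category* D] {U U' V V' W : D} (o : U ⟶ U')
    (p : U' ⟶ V) (i : V' ≅ V) (q : V ⟶ W) : (o ≫ p ≫ i.inv) ≫ i.hom ≫ q = o ≫ p ≫ q := by
  simp

/-! ### Transposition of chain maps against complexes in degree 0 -/

section Transposition

variable {C : Type u} [Category.{v} C] [Abelian C] {F G : C ⥤ C} [F.Additive] [G.Additive]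
  (adj : F ⊣ G)

/-- The canonical isomorphism `F (X[0]) ≅ (F X)[0]`. -/
noncomputable abbrev singleIso (F : C ⥤ C) [F.Additive] (X : C) :
    (F.mapHomologicalComplex (ComplexShape.up ℤ)).obj ((single₀ C).obj X) ≅
      (single₀ C).obj (F.obj X) :=
  (HomologicalComplex.singleMapHomologicalComplex F (ComplexShape.up ℤ) 0).app X

lemma map_comp_transposeLeft {K K' L : CochainComplex C ℤ} (b : K' ⟶ K)
    (φ : K ⟶ (G.mapHomologicalComplex (ComplexShape.up ℤ)).obj L) :
    (F.mapHomologicalComplex (ComplexShape.up ℤ)).map b ≫ transposeLeft adj φ =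
      transposeLeft adj (b ≫ φ) := by
  ext i
  exact (adj.homEquiv_naturality_left_symm (b.f i) (φ.f i)).symm

lemma transposeLeft_comp_map {K L L' : CochainComplex C ℤ} (b : L ⟶ L')
    (φ : K ⟶ (G.mapHomologicalComplex (ComplexShape.up ℤ)).obj L) :
    transposeLeft adj (φ ≫ (G.mapHomologicalComplex (ComplexShape.up ℤ)).map b) =
      transposeLeft adj φ ≫ b := by
  ext i
  exact adj.homEquiv_naturality_right_symm (φ.f i) (b.f i)

lemma transposeLeft_single {Z W : C} (f : Z ⟶ G.obj W) :
    transposeLeft adj ((single₀ C).map f ≫ (singleIso G W).inv) =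
      (singleIso F Z).hom ≫ (single₀ C).map ((adj.homEquiv Z W).symm f) := by
  apply HomologicalComplex.to_single_hom_ext
  change (adj.homEquiv _ _).symm (((single₀ C).map f).f 0 ≫ _) = _
  simp only [HomologicalComplex.comp_f, HomologicalComplex.single_map_f_self, Iso.app_hom,
    Iso.app_inv, HomologicalComplex.singleMapHomologicalComplex_hom_app_self,
    HomologicalComplex.singleMapHomologicalComplex_inv_app_self, Category.assoc,
    Iso.inv_hom_id_assoc]
  rw [adj.homEquiv_naturality_left_symm, adj.homEquiv_naturality_right_symm]
  exact (comp_inv_comp_hom_comp _ (HomologicalComplex.singleObjXSelf _ _ _) _).symm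

lemma map_comp_transposeLeft_of_comp_eq {K L : CochainComplex C ℤ} {Z W : C}
    (b' : (single₀ C).obj Z ⟶ K) (φ : K ⟶ (G.mapHomologicalComplex (ComplexShape.up ℤ)).obj L)
    (ι : Z ⟶ G.obj W) (b : (single₀ C).obj W ⟶ L)
    (h : b' ≫ φ = (single₀ C).map ι ≫ (singleIso G W).inv ≫
      (G.mapHomologicalComplex (ComplexShape.up ℤ)).map b) :
    (F.mapHomologicalComplex (ComplexShape.up ℤ)).map b' ≫ transposeLeft adj φ =
      (singleIso F Z).hom ≫ (single₀ C).map ((adj.homEquiv Z W).symm ι) ≫ b := by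
  rw [map_comp_transposeLeft, h, ← Category.assoc, transposeLeft_comp_map, transposeLeft_single,
    Category.assoc]

lemma transposeRight_comp_map {K L L' : CochainComplex C ℤ} (b : L ⟶ L')
    (φ : (F.mapHomologicalComplex (ComplexShape.up ℤ)).obj K ⟶ L) :
    transposeRight adj φ ≫ (G.mapHomologicalComplex (ComplexShape.up ℤ)).map b =
      transposeRight adj (φ ≫ b) := by
  ext i
  exact (adj.homEquiv_naturality_right (φ.f i) (b.f i)).symm

lemma transposeRight_map_comp {K K' L : CochainComplex C ℤ} (b : K' ⟶ K)
    (φ : (F.mapHomologicalComplex (ComplexShape.up ℤ)).obj K ⟶ L) :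
    transposeRight adj ((F.mapHomologicalComplex (ComplexShape.up ℤ)).map b ≫ φ) =
      b ≫ transposeRight adj φ := by
  ext i
  exact adj.homEquiv_naturality_left (b.f i) (φ.f i)

lemma transposeRight_single {Z W : C} (f : F.obj Z ⟶ W) :
    transposeRight adj ((singleIso F Z).hom ≫ (single₀ C).map f) =
      (single₀ C).map (adj.homEquiv Z W f) ≫ (singleIso G W).inv := by
  apply HomologicalComplex.from_single_hom_ext
  change adj.homEquiv _ _ (((singleIso F Z).hom).f 0 ≫ _) = _
  simp only [HomologicalComplex.comp_f, HomologicalComplex.single_map_f_self, Iso.app_hom,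
    Iso.app_inv, HomologicalComplex.singleMapHomologicalComplex_hom_app_self,
    HomologicalComplex.singleMapHomologicalComplex_inv_app_self, Category.assoc,
    Iso.inv_hom_id_assoc]
  rw [adj.homEquiv_naturality_left, adj.homEquiv_naturality_right]
  exact (comp_comp_inv_comp_hom_comp _ _ (HomologicalComplex.singleObjXSelf _ _ _) _).symm

lemma transposeRight_comp_map_of_comp_eq {K L : CochainComplex C ℤ} {Z W : C}
    (b' : L ⟶ (single₀ C).obj W) (φ : (F.mapHomologicalComplex (ComplexShape.up ℤ)).obj K ⟶ L)
    (p : F.obj Z ⟶ W) (b : K ⟶ (single₀ C).obj Z)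
    (h : φ ≫ b' = ((F.mapHomologicalComplex (ComplexShape.up ℤ)).map b ≫ (singleIso F Z).hom) ≫
      (single₀ C).map p) :
    transposeRight adj φ ≫ (G.mapHomologicalComplex (ComplexShape.up ℤ)).map b' =
      b ≫ (single₀ C).map (adj.homEquiv Z W p) ≫ (singleIso G W).inv := by
  rw [transposeRight_comp_map, h, Category.assoc, transposeRight_map_comp, transposeRight_single]

end Transposition

lemma acyclic_iff_isZero {C : Type u} [Category.{v} C] [Abelian C] {K : CochainComplex C ℤ} {Z : C}
    (h : (∃ a : (single₀ C).obj Z ⟶ K, QuasiIso a) ∨ ∃ a : K ⟶ (single₀ C).obj Z, QuasiIso a) :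
    K.Acyclic ↔ IsZero Z := by
  have h1 : K.Acyclic ↔ ((single₀ C).obj Z).Acyclic := by
    rcases h with ⟨a, ha⟩ | ⟨a, ha⟩
    · exact forall_congr' fun i => (exactAt_iff_of_quasiIsoAt a i).symm
    · exact forall_congr' fun i => exactAt_iff_of_quasiIsoAt a i
  rw [h1]
  constructor
  · intro hac
    exact ((hac 0).isZero_homology).of_iso
      (HomologicalComplex.singleObjHomologySelfIso (ComplexShape.up ℤ) 0 Z).symm
  · intro hZ i
    rw [HomologicalComplex.exactAt_iff_isZero_homology]
    exact (HomologicalComplex.homologyFunctor C _ i).map_isZero ((single₀ C).map_isZero hZ)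

/-! ### Continuant complexes versus continuant objects -/

section Comparison

variable {C : Type u} [Category.{v} C] [Abelian C] [MonoidalCategory C] [MonoidalPreadditive C]
  [RigidCategory C]

/-- The compatibility of the two quasi-isomorphisms with the transition maps is carried along
because it is the input of the next cocone comparison. -/
lemma exists_quasiIso_lowerStage (X : C) (n : ℕ) (h : ∀ m < n, Epi (lower X m).map) :
    ∃ (a : (single₀ C).obj (lower X n).prev ⟶ (lowerStage X n).prev)
      (b : (single₀ C).obj (lower X n).next ⟶ (lowerStage X n).next),
      QuasiIso a ∧ QuasiIso b ∧ (leftTensor (iterDual X (n + 1))).map b ≫ (lowerStage X n).map =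
        (singleIso (tensorLeft (iterDual X (n + 1))) _).hom ≫
          (single₀ C).map (lower X n).map ≫ a := by
  induction n with
  | zero =>
    refine ⟨𝟙 ((single₀ C).obj (𝟙_ C)), 𝟙 ((single₀ C).obj X),
      inferInstanceAs (QuasiIso (𝟙 ((single₀ C).obj (𝟙_ C)))),
      inferInstanceAs (QuasiIso (𝟙 ((single₀ C).obj X))), ?_⟩
    exact (congrArg (· ≫ _) (CategoryTheory.Functor.map_id _ _)).trans ((Category.id_comp _).trans
      (congrArg (_ ≫ ·) (Category.comp_id _).symm))
  | succ n ih =>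
    obtain ⟨a, b, ha, hb, hab⟩ := ih fun m hm => h m (by omega)
    have hepi : Epi (lower X n).map := h n (by omega)
    let e := singleIso (tensorLeft (iterDual X (n + 1))) (lower X n).next
    let k := e.inv ≫ (leftTensor (iterDual X (n + 1))).map b
    have hk : QuasiIso k := inferInstance
    obtain ⟨b', hb', hbb'⟩ := exists_quasiIso_cocone (lowerStage X n).map (lower X n).map k a hk ha
      (by rw [Category.assoc, hab, Iso.inv_hom_id_assoc])
    refine ⟨b, b', hb, hb', ?_⟩
    exact map_comp_transposeLeft_of_comp_eq _ b' _ _ b hbb'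

lemma exists_quasiIso_upperStage (X : C) (n : ℕ) (h : ∀ m < n, Epi (upper X m).map) :
    ∃ (a : (upperStage X n).prev ⟶ (single₀ C).obj (upper X n).prev.unop)
      (b : (upperStage X n).next ⟶ (single₀ C).obj (upper X n).next.unop),
      QuasiIso a ∧ QuasiIso b ∧ (upperStage X n).map ≫ (rightTensor (iterDual X (n + 1))).map b =
        a ≫ (single₀ C).map (upper X n).map.unop ≫
          (singleIso (tensorRight (iterDual X (n + 1))) _).inv := by
  induction n with
  | zero =>
    refine ⟨𝟙 ((single₀ C).obj (𝟙_ C)), 𝟙 ((single₀ C).obj X),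
      inferInstanceAs (QuasiIso (𝟙 ((single₀ C).obj (𝟙_ C)))),
      inferInstanceAs (QuasiIso (𝟙 ((single₀ C).obj X))), ?_⟩
    exact (congrArg (_ ≫ ·) (CategoryTheory.Functor.map_id _ _)).trans ((Category.comp_id _).trans
      (Category.id_comp _).symm)
  | succ n ih =>
    obtain ⟨a, b, ha, hb, hab⟩ := ih fun m hm => h m (by omega)
    have hepi : Epi (upper X n).map := h n (by omega)
    have hmono : Mono (upper X n).map.unop := inferInstance
    let e := singleIso (tensorRight (iterDual X (n + 1))) (upper X n).next.unop
    let l := (rightTensor (iterDual X (n + 1))).map b ≫ e.hom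
    have hl : QuasiIso l := inferInstance
    obtain ⟨b', hb', hbb'⟩ := exists_quasiIso_cone (upperStage X n).map (upper X n).map.unop a l ha
      hl (by rw [← Category.assoc, hab, Category.assoc, Category.assoc, Iso.inv_hom_id,
          Category.comp_id])
      (kernel.ι (upper X n).map).unop _
      (KernelFork.IsLimit.ofιUnop _ (kernel.condition (upper X n).map)
        (kernelIsKernel (upper X n).map))
    refine ⟨b, b', hb, hb', ?_⟩
    have hadj : (upper X (n + 1)).map.unop =
        (tensorRightAdjunction (iterDual X (n + 1)) (iterDual X (n + 2))).homEquiv _ _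
          (kernel.ι (upper X n).map).unop := by
      change (((rightChainAdj X (n + 1)).homEquiv _ _).symm (kernel.ι (upper X n).map)).unop = _
      rw [Adjunction.homEquiv_counit, Adjunction.homEquiv_unit]
      rfl
    rw [hadj]
    exact transposeRight_comp_map_of_comp_eq _ b' _ _ b hbb'

lemma acyclic_lowerContinuant_iff [Simple (𝟙_ C)] (X : C) (n : ℕ)
    (h : ∀ m < n, ¬ IsZero (lowerObj X m)) :
    (lowerContinuant X n).Acyclic ↔ IsZero (lowerObj X n) := by
  cases n with
  | zero => exact acyclic_iff_isZero (Or.inl ⟨𝟙 ((single₀ C).obj (𝟙_ C)), inferInstanceAs (QuasiIso (𝟙 ((single₀ C).obj (𝟙_ C))))⟩)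
  | succ n =>
    obtain ⟨a, b, ha, hb, -⟩ := exists_quasiIso_lowerStage X n
      (fun m hm => epi_lower_map X m fun j hj => h j (by omega))
    exact acyclic_iff_isZero (Or.inl ⟨b, hb⟩)

lemma acyclic_upperContinuant_iff [Simple (𝟙_ C)] (X : C) (n : ℕ)
    (h : ∀ m < n, ¬ IsZero (upperObj X m)) :
    (upperContinuant X n).Acyclic ↔ IsZero (upperObj X n) := by
  cases n with
  | zero => exact acyclic_iff_isZero (Or.inr ⟨𝟙 ((single₀ C).obj (𝟙_ C)), inferInstanceAs (QuasiIso (𝟙 ((single₀ C).obj (𝟙_ C))))⟩)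
  | succ n =>
    obtain ⟨a, b, ha, hb, -⟩ := exists_quasiIso_upperStage X n
      (fun m hm => epi_upper_map X m fun j hj => h j (by omega))
    exact acyclic_iff_isZero (Or.inr ⟨b, hb⟩)

end Comparison

/-! ### Continuants of a 2-periodic sequence in a noncommutative ring -/

section ContinuantRing

/-- The continuant polynomials of a sequence, built by multiplication on the left. -/
def leftContinuant {R : Type*} [Ring R] (c : ℕ → R) : ℕ → R
  | 0 => 1
  | 1 => c 0
  | n + 2 => c (n + 1) * leftContinuant c (n + 1) - leftContinuant c n

/-- The continuant polynomials of a sequence, built by multiplication on the right. -/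
def rightContinuant {R : Type*} [Ring R] (c : ℕ → R) : ℕ → R
  | 0 => 1
  | 1 => c 0
  | n + 2 => rightContinuant c (n + 1) * c (n + 1) - rightContinuant c n

variable {R : Type*} {c : ℕ → R} (hc : ∀ n, c (n + 2) = c n)

include hc

lemma periodic_even (k : ℕ) : c (2 * k) = c 0 := by
  induction k with
  | zero => rfl
  | succ k ih => exact (hc _).trans ih

lemma periodic_odd (k : ℕ) : c (2 * k + 1) = c 1 := by
  induction k with
  | zero => rfl
  | succ k ih => exact (hc _).trans ih

/-- Even left continuants are polynomials in c₁c₀, even right ones the same polynomials in c₀c₁; odd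
ones are combinations of palindromic words, hence equal. The last two clauses are the commutation
rules that drive the induction. -/
lemma continuant_comparison [Ring R] (k : ℕ) :
    leftContinuant c (2 * k + 1) = rightContinuant c (2 * k + 1) ∧
    c 0 * leftContinuant c (2 * k) = rightContinuant c (2 * k) * c 0 ∧
    c 1 * c 0 * leftContinuant c (2 * k) = leftContinuant c (2 * k) * (c 1 * c 0) ∧
    c 0 * c 1 * leftContinuant c (2 * k + 1) = leftContinuant c (2 * k + 1) * (c 1 * c 0) := by
  induction k with
  | zero => simp [leftContinuant, rightContinuant, mul_assoc]
  | succ k ih =>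
    obtain ⟨h1, h2, h3, h4⟩ := ih
    have e1 : leftContinuant c (2 * (k + 1)) =
        c 1 * leftContinuant c (2 * k + 1) - leftContinuant c (2 * k) := by
      rw [← periodic_odd hc k]; rfl
    have e2 : leftContinuant c (2 * (k + 1) + 1) =
        c 0 * leftContinuant c (2 * (k + 1)) - leftContinuant c (2 * k + 1) := by
      rw [← periodic_even hc (k + 1)]; rfl
    have u1 : rightContinuant c (2 * (k + 1)) =
        rightContinuant c (2 * k + 1) * c 1 - rightContinuant c (2 * k) := by
      rw [← periodic_odd hc k]; rfl
    have u2 : rightContinuant c (2 * (k + 1) + 1) =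
        rightContinuant c (2 * (k + 1)) * c 0 - rightContinuant c (2 * k + 1) := by
      rw [← periodic_even hc (k + 1)]; rfl
    have h5 : c 0 * leftContinuant c (2 * (k + 1)) = rightContinuant c (2 * (k + 1)) * c 0 := by
      rw [e1, u1, mul_sub, sub_mul, ← h2, ← h1, ← mul_assoc, h4, mul_assoc]
    have h6 : c 1 * c 0 * leftContinuant c (2 * (k + 1)) =
        leftContinuant c (2 * (k + 1)) * (c 1 * c 0) := by
      rw [e1, mul_sub, sub_mul, h3, mul_assoc (c 1) _ (c 1 * c 0), ← h4]
      simp only [mul_assoc]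
    refine ⟨?_, h5, h6, ?_⟩
    · rw [e2, u2, h5, h1]
    · rw [e2, mul_sub, sub_mul, h4, mul_assoc (c 0) _ (c 1 * c 0), ← h6]
      simp only [mul_assoc]

end ContinuantRing

/-- An isomorphism of objects induces an isomorphism of their duals. -/
@[simps]
def rightDualMapIso {C : Type u} [Category.{v} C] [MonoidalCategory C] [RightRigidCategory C]
    {A B : C} (e : A ≅ B) : (Aᘁ : C) ≅ (Bᘁ : C) where
  hom := e.invᘁ
  inv := e.homᘁ
  hom_inv_id := by
    rw [← comp_rightAdjointMate]
    simp
  inv_hom_id := by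
    rw [← comp_rightAdjointMate]
    simp

/-! ### Additive functions and the class ring -/

section AdditiveFunctions

variable (C : Type u) [Category.{v} C] [Abelian C]

/-- The additive functions on `C`: the dual of its Grothendieck group. -/
def additiveFn : AddSubgroup (C → ℤ) where
  carrier := {φ | ∀ S : ShortComplex C, S.ShortExact → φ S.X₂ = φ S.X₁ + φ S.X₃}
  add_mem' {φ ψ} hφ hψ S hS := by
    simp only [Pi.add_apply, hφ S hS, hψ S hS]
    ring
  zero_mem' S hS := by simp
  neg_mem' {φ} hφ S hS := by
    simp only [Pi.neg_apply, hφ S hS]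
    ring

variable {C}

lemma additiveFn_isZero (φ : additiveFn C) {Z : C} (hZ : IsZero Z) : φ.1 Z = 0 := by
  have h := φ.2 (ShortComplex.mk (0 : Z ⟶ Z) (0 : Z ⟶ Z) (by simp))
    { exact := ShortComplex.exact_of_isZero_X₂ _ hZ
      mono_f := ⟨fun _ _ _ => hZ.eq_of_tgt _ _⟩
      epi_g := ⟨fun _ _ _ => hZ.eq_of_src _ _⟩ }
  simpa using h

lemma additiveFn_iso (φ : additiveFn C) {A B : C} (e : A ≅ B) : φ.1 A = φ.1 B := by
  have h := φ.2 (ShortComplex.mk e.hom (0 : B ⟶ (0 : C)) (by simp))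
    { exact := by
        rw [ShortComplex.exact_iff_epi _ rfl]
        exact (inferInstance : Epi e.hom)
      mono_f := (inferInstance : Mono e.hom)
      epi_g := ⟨fun _ _ _ => (isZero_zero C).eq_of_src _ _⟩ }
  have h0 := additiveFn_isZero φ (isZero_zero C)
  simp only at h
  omega

variable (C) in
/-- A ring receiving the classes of the objects of `C`. -/
abbrev ClassRing : Type u := (AddMonoid.End (additiveFn C))ᵐᵒᵖ

lemma classRing_ext {r s : ClassRing C} (h : ∀ φ B, (r.unop φ).1 B = (s.unop φ).1 B) : r = s := by
  apply MulOpposite.unop_injective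
  ext φ B
  exact h φ B

variable [MonoidalCategory C] [MonoidalPreadditive C] [RigidCategory C]

/-- The action of an object on additive functions. -/
def classEnd (A : C) : AddMonoid.End (additiveFn C) where
  toFun φ := ⟨fun B => φ.1 (A ⊗ B), fun S hS =>
    φ.2 (S.map (tensorLeft A)) (hS.map_of_exact (tensorLeft A))⟩
  map_zero' := rfl
  map_add' _ _ := rfl

/-- The class of an object of `C`. -/
def cls (A : C) : ClassRing C := MulOpposite.op (classEnd A)

lemma cls_iso {A B : C} (e : A ≅ B) : cls A = cls B :=
  classRing_ext fun φ D => additiveFn_iso φ (whiskerRightIso e D)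

/-- The actions on additive functions compose in reverse order; passing to the opposite ring
restores it. -/
lemma cls_tensor (A B : C) : cls (A ⊗ B) = cls A * cls B :=
  classRing_ext fun φ D => additiveFn_iso φ (α_ A B D)

lemma cls_unit : cls (𝟙_ C) = 1 :=
  classRing_ext fun φ D => additiveFn_iso φ (λ_ D)

lemma cls_shortExact {S : ShortComplex C} (hS : S.ShortExact) :
    cls S.X₂ = cls S.X₁ + cls S.X₃ :=
  classRing_ext fun φ D => φ.2 (S.map (tensorRight D)) (hS.map_of_exact (tensorRight D))

lemma cls_isZero {Z : C} (hZ : IsZero Z) : cls Z = 0 :=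
  classRing_ext fun φ D => additiveFn_isZero φ (isZero_tensor_right D hZ)

/-- The length, as an additive function. -/
noncomputable def lenFn (hlen : ∀ X : C, objLength X ≠ ⊤) : additiveFn C :=
  ⟨fun X => (len X : ℤ), fun S hS => by
    have h := len_add hS (hlen _) (hlen _) (hlen _)
    push_cast [h]
    rfl⟩

/-- The length of an element of the class ring. -/
noncomputable def clsLen (hlen : ∀ X : C, objLength X ≠ ⊤) : ClassRing C →+ ℤ where
  toFun r := (r.unop (lenFn hlen)).1 (𝟙_ C)
  map_zero' := rfl
  map_add' _ _ := rfl

lemma clsLen_cls (hlen : ∀ X : C, objLength X ≠ ⊤) (A : C) : clsLen hlen (cls A) = len A :=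
  additiveFn_iso (lenFn hlen) (ρ_ A)

lemma isZero_of_cls_eq_zero (hlen : ∀ X : C, objLength X ≠ ⊤) {A : C} (h : cls A = 0) :
    IsZero A := by
  rw [← len_eq_zero_iff (hlen A)]
  have := clsLen_cls hlen A
  rw [h, map_zero] at this
  omega

/-- The classes of the iterated duals of `X`. -/
def dualCls (X : C) (n : ℕ) : ClassRing C := cls (iterDual X n)

lemma dualCls_add_two {X : C} (hX : Nonempty (((Xᘁ : C)ᘁ : C) ≅ X)) (n : ℕ) :
    dualCls X (n + 2) = dualCls X n := by
  have h : ∀ n, Nonempty (iterDual X (n + 2) ≅ iterDual X n) := by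
    intro n
    induction n with
    | zero => exact hX
    | succ n ih =>
      obtain ⟨e⟩ := ih
      exact ⟨rightDualMapIso e⟩
  exact cls_iso (h n).some

lemma cls_lowerObj [Simple (𝟙_ C)] (X : C) (n : ℕ) (h : ∀ m < n, ¬ IsZero (lowerObj X m)) :
    cls (lowerObj X n) = leftContinuant (dualCls X) n := by
  induction n using Nat.strong_induction_on with
  | _ n ih =>
    match n with
    | 0 => exact cls_unit
    | 1 => rfl
    | n + 2 =>
      have hepi : Epi (lower X n).map := epi_lower_map X n fun m hm => h m (by omega)
      have hS : (ShortComplex.mk (kernel.ι (lower X n).map) (lower X n).map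
          (kernel.condition _)).ShortExact :=
        { exact := ShortComplex.exact_kernel _ }
      have h1 : cls (iterDual X (n + 1) ⊗ lowerObj X (n + 1)) =
        cls (lowerObj X (n + 2)) + cls (lowerObj X n) := cls_shortExact hS
      rw [cls_tensor, ih (n + 1) (by omega) fun m hm => h m (by omega),
        ih n (by omega) fun m hm => h m (by omega)] at h1
      exact eq_sub_of_add_eq h1.symm

lemma cls_upperObj [Simple (𝟙_ C)] (X : C) (n : ℕ) (h : ∀ m < n, ¬ IsZero (upperObj X m)) :
    cls (upperObj X n) = rightContinuant (dualCls X) n := by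
  induction n using Nat.strong_induction_on with
  | _ n ih =>
    match n with
    | 0 => exact cls_unit
    | 1 => rfl
    | n + 2 =>
      have hepi : Epi (upper X n).map := epi_upper_map X n fun m hm => h m (by omega)
      have hS : (ShortComplex.mk (kernel.ι (upper X n).map) (upper X n).map
          (kernel.condition _)).ShortExact :=
        { exact := ShortComplex.exact_kernel _ }
      have h1 : cls (upperObj X (n + 1) ⊗ iterDual X (n + 1)) =
        cls (upperObj X n) + cls (upperObj X (n + 2)) := cls_shortExact hS.unop
      rw [cls_tensor, ih (n + 1) (by omega) fun m hm => h m (by omega),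
        ih n (by omega) fun m hm => h m (by omega)] at h1
      exact eq_sub_of_add_eq' h1.symm

omit [MonoidalPreadditive C] in
lemma not_isZero_lowerObj_zero [Simple (𝟙_ C)] (X : C) : ¬ IsZero (lowerObj X 0) :=
  Simple.not_isZero (𝟙_ C)

/-- For odd `n` the two objects have the same class, and length detects zero. For even `n` only X ⊗
E_n and E^n ⊗ X have the same class, and the absence of zero divisors removes the nonzero factor
`X`. -/
lemma isZero_lowerObj_iff_upperObj [Simple (𝟙_ C)] (hlen : ∀ X : C, objLength X ≠ ⊤) {X : C}
    (hX : Nonempty (((Xᘁ : C)ᘁ : C) ≅ X)) (n : ℕ) (h : ∀ m < n, ¬ IsZero (lowerObj X m))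
    (h' : ∀ m < n, ¬ IsZero (upperObj X m)) : IsZero (lowerObj X n) ↔ IsZero (upperObj X n) := by
  have hl := cls_lowerObj X n h
  have hu := cls_upperObj X n h'
  have key := continuant_comparison (dualCls_add_two hX)
  rcases Nat.even_or_odd' n with ⟨k, rfl | rfl⟩
  · cases k with
    | zero => exact Iff.rfl
    | succ k =>
      have hX0 : ¬ IsZero X := h 1 (by omega)
      have h2 : cls (X ⊗ lowerObj X (2 * (k + 1))) = cls (upperObj X (2 * (k + 1)) ⊗ X) := by
        rw [cls_tensor, cls_tensor, hl, hu]
        exact (key (k + 1)).2.1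
      constructor
      · intro hz
        rw [cls_isZero (isZero_tensor_left X hz)] at h2
        exact (isZero_or_isZero_of_isZero_tensor
          (isZero_of_cls_eq_zero hlen h2.symm)).resolve_right hX0
      · intro hz
        rw [cls_isZero (isZero_tensor_right X hz)] at h2
        exact (isZero_or_isZero_of_isZero_tensor
          (isZero_of_cls_eq_zero hlen h2)).resolve_left hX0
  · rw [(key k).1, ← hu] at hl
    exact ⟨fun hz => isZero_of_cls_eq_zero hlen (hl ▸ cls_isZero hz),
      fun hz => isZero_of_cls_eq_zero hlen (hl.symm ▸ cls_isZero hz)⟩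

end AdditiveFunctions

/-! ### Path counting on Dynkin diagrams of type A -/

section PathCounting

variable {H : ℕ → ℕ → ℝ} (h0 : ∀ t, H 0 t = 0)
  (hrec : ∀ n t, H (n + 1) (t + 1) = H (n + 2) t + H n t)

include h0 hrec

/-- The vector sin(nθ) is an eigenvector of the path adjacency with eigenvalue 2cos θ; truncation at
`m` leaves two boundary terms. At θ = π/(m+1) the negative one disappears. -/
lemma sum_sin_mul_path (θ : ℝ) (m t : ℕ) :
    ∑ n ∈ Finset.range (m + 1), Real.sin (n * θ) * H n (t + 1) =
      2 * Real.cos θ * ∑ n ∈ Finset.range (m + 1), Real.sin (n * θ) * H n t +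
        Real.sin (m * θ) * H (m + 1) t - Real.sin ((m + 1) * θ) * H m t := by
  induction m with
  | zero => simp [h0]
  | succ m ih =>
    rw [Finset.sum_range_succ, ih, Finset.sum_range_succ _ (m + 1), hrec]
    have e1 : Real.sin (m * θ) = Real.sin ((m + 1) * θ) * Real.cos θ -
        Real.cos ((m + 1) * θ) * Real.sin θ := by
      rw [← Real.sin_sub]; ring_nf
    have e2 : Real.sin ((m + 1 + 1) * θ) = Real.sin ((m + 1) * θ) * Real.cos θ +
        Real.cos ((m + 1) * θ) * Real.sin θ := by
      rw [← Real.sin_add]; ring_nf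
    push_cast
    rw [e1, e2]
    ring

lemma sum_sin_pi_mul_path (m t : ℕ) :
    ∑ n ∈ Finset.range (m + 1), Real.sin (n * (Real.pi / (m + 1 : ℕ))) * H n (t + 1) =
      2 * Real.cos (Real.pi / (m + 1 : ℕ)) *
        ∑ n ∈ Finset.range (m + 1), Real.sin (n * (Real.pi / (m + 1 : ℕ))) * H n t +
        Real.sin (m * (Real.pi / (m + 1 : ℕ))) * H (m + 1) t := by
  rw [sum_sin_mul_path h0 hrec]
  have : ((m : ℝ) + 1) * (Real.pi / (m + 1 : ℕ)) = Real.pi := by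
    push_cast
    field_simp
  rw [this, Real.sin_pi]
  ring

omit h0 hrec in
lemma sin_mul_pi_div_nonneg {m n : ℕ} (hn : n ≤ m) :
    0 ≤ Real.sin (n * (Real.pi / (m + 1 : ℕ))) := by
  apply Real.sin_nonneg_of_nonneg_of_le_pi (by positivity)
  rw [mul_div_left_comm]
  refine mul_le_of_le_one_right Real.pi_pos.le ((div_le_one (by positivity)).2 ?_)
  exact_mod_cast hn.trans m.le_succ

omit h0 hrec in
lemma sin_pi_div_pos {m : ℕ} (hm : 0 < m) : 0 < Real.sin (1 * (Real.pi / (m + 1 : ℕ))) := by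
  rw [one_mul]
  apply Real.sin_pos_of_pos_of_lt_pi (by positivity)
  apply div_lt_self Real.pi_pos
  exact_mod_cast Nat.succ_lt_succ hm

omit h0 hrec in
lemma two_cos_nonneg {m : ℕ} (hm : 0 < m) : 0 ≤ 2 * Real.cos (Real.pi / (m + 1 : ℕ)) := by
  have : Real.pi / (m + 1 : ℕ) ≤ Real.pi / 2 := by
    apply div_le_div_of_nonneg_left Real.pi_pos.le (by norm_num)
    exact_mod_cast Nat.succ_le_succ hm
  have h1 : 0 < Real.pi / (m + 1 : ℕ) := by positivity
  have := Real.cos_nonneg_of_mem_Icc (x := Real.pi / (m + 1 : ℕ))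
    ⟨by linarith [Real.pi_pos], this⟩
  linarith

omit h0 hrec in
lemma sin_mul_le_sum_path {m : ℕ} (hm : 0 < m) (hpos : ∀ n ≤ m, ∀ t, 0 ≤ H n t) (t : ℕ) :
    Real.sin (1 * (Real.pi / (m + 1 : ℕ))) * H 1 t ≤
      ∑ n ∈ Finset.range (m + 1), Real.sin (n * (Real.pi / (m + 1 : ℕ))) * H n t := by
  have := Finset.single_le_sum (s := Finset.range (m + 1))
    (f := fun n : ℕ => Real.sin (n * (Real.pi / (m + 1 : ℕ))) * H n t) (a := 1)
    (fun n hn => mul_nonneg (sin_mul_pi_div_nonneg (by simp at hn; omega))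
      (hpos n (by simp at hn; omega) t)) (by simp; omega)
  simpa using this

/-- With nothing beyond vertex `m`, the sine-weighted total is exactly geometric, and vertex 1
contributes a fixed positive weight to it. -/
lemma exists_path_le {m : ℕ} (hm : 0 < m) (hpos : ∀ n ≤ m, ∀ t, 0 ≤ H n t)
    (hzero : ∀ t, H (m + 1) t = 0) :
    ∃ K : ℝ, ∀ t, H 1 t ≤ K * (2 * Real.cos (Real.pi / (m + 1 : ℕ))) ^ t := by
  set V : ℕ → ℝ := fun t =>
    ∑ n ∈ Finset.range (m + 1), Real.sin (n * (Real.pi / (m + 1 : ℕ))) * H n t with hV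
  have hVt : ∀ t, V t = V 0 * (2 * Real.cos (Real.pi / (m + 1 : ℕ))) ^ t := by
    intro t
    induction t with
    | zero => simp
    | succ t ih =>
      have := sum_sin_pi_mul_path h0 hrec m t
      rw [hzero, mul_zero, add_zero] at this
      change V (t + 1) = _ * V t at this
      rw [this, ih]
      ring
  refine ⟨V 0 / Real.sin (1 * (Real.pi / (m + 1 : ℕ))), fun t => ?_⟩
  rw [div_mul_eq_mul_div, le_div_iff₀ (sin_pi_div_pos hm), mul_comm, ← hVt]
  exact sin_mul_le_sum_path hm hpos t

omit h0 in
lemma path_le_path_one {m : ℕ} (hpos : ∀ n ≤ m, ∀ t, 0 ≤ H n t) (n : ℕ) (hn : n < m) (t : ℕ) :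
    H (n + 1) t ≤ H 1 (t + n) := by
  induction n generalizing t with
  | zero => exact le_rfl
  | succ n ih =>
    have := ih (by omega) (t + 1)
    rw [hrec] at this
    have h1 := hpos n (by omega) t
    rw [show t + (n + 1) = t + 1 + n by ring]
    linarith

/-- The boundary term is nonnegative, so the weighted total grows at least geometrically; it is
bounded above by values at vertex 1 at later times, since walking back from vertex n + 1 takes n
steps. -/
lemma pow_le_sum_path {m : ℕ} (hm : 0 < m) (hpos : ∀ n ≤ m + 1, ∀ t, 0 ≤ H n t)
    (hone : 1 ≤ H 1 0) (t : ℕ) :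
    Real.sin (1 * (Real.pi / (m + 1 : ℕ))) * (2 * Real.cos (Real.pi / (m + 1 : ℕ))) ^ t ≤
      ∑ n ∈ Finset.range m, H 1 (t + n) := by
  set V : ℕ → ℝ := fun t =>
    ∑ n ∈ Finset.range (m + 1), Real.sin (n * (Real.pi / (m + 1 : ℕ))) * H n t with hV
  have hVt : ∀ t, Real.sin (1 * (Real.pi / (m + 1 : ℕ))) *
      (2 * Real.cos (Real.pi / (m + 1 : ℕ))) ^ t ≤ V t := by
    intro t
    induction t with
    | zero =>
      refine le_trans ?_ (sin_mul_le_sum_path hm (fun n hn => hpos n (by omega)) 0)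
      rw [pow_zero]
      exact mul_le_mul_of_nonneg_left hone (sin_pi_div_pos hm).le
    | succ t ih =>
      have h1 := sum_sin_pi_mul_path h0 hrec m t
      change V (t + 1) = _ * V t + _ at h1
      have h2 := mul_nonneg (sin_mul_pi_div_nonneg (le_refl m)) (hpos (m + 1) le_rfl t)
      have h3 := mul_le_mul_of_nonneg_left ih (two_cos_nonneg hm)
      rw [pow_succ, h1]
      linarith
  refine (hVt t).trans ?_
  simp only [hV]
  rw [Finset.sum_range_succ', h0, mul_zero, add_zero]
  refine Finset.sum_le_sum fun n hn => ?_
  have hn' : n < m := Finset.mem_range.1 hn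
  refine (mul_le_of_le_one_left (hpos _ (by omega) t) (Real.sin_le_one _)).trans ?_
  exact path_le_path_one hrec (fun n hn => hpos n (by omega)) n hn' t

end PathCounting

/-! ### Limits of roots of supermultiplicative sequences -/

section Growth

lemma le_of_forall_mul_pow_le {a b ε K : ℝ} (ha : 0 ≤ a) (hb : 0 ≤ b) (hε : 0 < ε)
    (h : ∀ i : ℕ, ε * a ^ i ≤ K * b ^ i) : a ≤ b := by
  by_contra! hab
  have ha0 : 0 < a := hb.trans_lt hab
  have ht := (tendsto_pow_atTop_nhds_zero_of_lt_one (div_nonneg hb ha)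
    ((div_lt_one ha0).2 hab)).const_mul K
  rw [mul_zero] at ht
  obtain ⟨i, hi⟩ := (ht.eventually (gt_mem_nhds hε)).exists
  have h1 := h i
  rw [div_pow, mul_div_assoc', div_lt_iff₀ (pow_pos ha0 i)] at hi
  linarith

/-- The sequence of `i`-th roots of a sequence of natural numbers. -/
noncomputable def rootSeq (s : ℕ → ℕ) (i : ℕ) : ℝ≥0∞ := (s i : ℝ≥0∞) ^ (1 / (i : ℝ))

variable {s : ℕ → ℕ} (hmul : ∀ i j, s i * s j ≤ s (i + j))

include hmul

/-- Half of Fekete's lemma, applied to the subadditive sequence -log s(i). -/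
lemma eventually_lt_rootSeq (hpos : ∀ i, 0 < s i) {a : ℝ≥0∞} {i : ℕ} (hi : i ≠ 0)
    (ha : a < rootSeq s i) : ∀ᶠ p in atTop, a < rootSeq s p := by
  have hsub : Subadditive fun i => -Real.log (s i) := by
    intro m n
    rw [← neg_add, neg_le_neg_iff, ← Real.log_mul (by exact_mod_cast (hpos m).ne')
      (by exact_mod_cast (hpos n).ne')]
    exact Real.log_le_log (by exact_mod_cast Nat.mul_pos (hpos m) (hpos n))
      (by exact_mod_cast hmul m n)
  by_cases ha0 : a = 0
  · subst ha0
    refine Eventually.of_forall fun p => ?_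
    exact ENNReal.rpow_pos (by exact_mod_cast hpos p) (ENNReal.natCast_ne_top _)
  have hatop : a ≠ ⊤ := ha.ne_top
  have har : 0 < a.toReal := ENNReal.toReal_pos ha0 hatop
  have key : ∀ p : ℕ, p ≠ 0 → (a < rootSeq s p ↔
      -Real.log (s p) / p < -Real.log a.toReal) := by
    intro p hp
    have hp' : (0 : ℝ) < p := by positivity
    have hsp : (0 : ℝ) < s p := by exact_mod_cast hpos p
    rw [neg_div, neg_lt_neg_iff, Real.log_lt_iff_lt_exp har, rootSeq,
      ← ENNReal.ofReal_natCast, ENNReal.ofReal_rpow_of_pos hsp,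
      ENNReal.lt_ofReal_iff_toReal_lt hatop, Real.rpow_def_of_pos hsp, mul_one_div]
  filter_upwards [hsub.eventually_div_lt_of_div_lt hi ((key i hi).1 ha), eventually_ne_atTop 0]
    with p hp hp0
  exact (key p hp0).2 hp

/-- The limit is the supremum over i ≠ 0; the term at 0 carries the junk exponent 1/0 = 0 and is
left out. -/
lemma exists_tendsto_rootSeq (hpos : (∀ i ≠ 0, s i = 0) ∨ ∀ i, 0 < s i) :
    ∃ L : ℝ≥0∞, Tendsto (rootSeq s) atTop (𝓝 L) ∧ ∀ i ≠ 0, rootSeq s i ≤ L := by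
  rcases hpos with hz | hpos
  · have hz : ∀ i ≠ 0, rootSeq s i = 0 := fun i hi => by
      rw [rootSeq, hz i hi, Nat.cast_zero, ENNReal.zero_rpow_of_pos (by positivity)]
    refine ⟨0, tendsto_const_nhds.congr' ?_, fun i hi => (hz i hi).le⟩
    filter_upwards [eventually_ne_atTop 0] with i hi
    exact (hz i hi).symm
  refine ⟨⨆ i : {i : ℕ // i ≠ 0}, rootSeq s i, tendsto_order.2 ⟨fun a ha => ?_, fun b hb => ?_⟩,
    fun i hi => le_iSup (fun i : {i : ℕ // i ≠ 0} => rootSeq s i) ⟨i, hi⟩⟩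
  · obtain ⟨⟨i, hi⟩, hai⟩ := lt_iSup_iff.1 ha
    exact eventually_lt_rootSeq hmul hpos hi hai
  · filter_upwards [eventually_ne_atTop 0] with i hi
    exact (le_iSup (fun i : {i : ℕ // i ≠ 0} => rootSeq s i) ⟨i, hi⟩).trans_lt hb

/-- Power trick: s(i)^m ≤ s(im) ≤ K b^(im) for all m removes the constant, so s(i) ≤ b^i. -/
lemma limit_rootSeq_le (hone : s 0 = 1) {L : ℝ≥0∞} (hL : Tendsto (rootSeq s) atTop (𝓝 L))
    {K b : ℝ} (hb : 0 ≤ b) (h : ∀ i, (s i : ℝ) ≤ K * b ^ i) : L ≤ ENNReal.ofReal b := by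
  refine le_of_tendsto hL ?_
  filter_upwards [eventually_ne_atTop 0] with i hi
  have hpow : ∀ m : ℕ, s i ^ m ≤ s (i * m) := by
    intro m
    induction m with
    | zero => simp [hone]
    | succ m ih => exact (Nat.mul_le_mul_right _ ih).trans (hmul _ _)
  have h1 : (s i : ℝ) ≤ b ^ i := by
    refine le_of_forall_mul_pow_le (ε := 1) (K := K) (by positivity) (by positivity) one_pos
      fun m => ?_
    rw [one_mul, ← pow_mul]
    exact le_trans (by exact_mod_cast hpow m) (h _)
  have h2 : (s i : ℝ≥0∞) ≤ ENNReal.ofReal b ^ i := by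
    rw [← ENNReal.ofReal_pow hb, ← ENNReal.ofReal_natCast]
    exact ENNReal.ofReal_le_ofReal h1
  rw [rootSeq, one_div]
  exact (ENNReal.rpow_inv_le_iff (by positivity)).2 (by rwa [ENNReal.rpow_natCast])

omit hmul in
-- Each s(i) is at most L^i, so finitely many bounded shifts of the index cost only a constant
-- factor.
lemma le_limit_rootSeq (hone : s 0 = 1) {L : ℝ≥0∞} (hL : ∀ i ≠ 0, rootSeq s i ≤ L) {ε a : ℝ}
    (hε : 0 < ε) (ha : 0 ≤ a) (m : ℕ) (f : ℕ → ℕ)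
    (h : ∀ i, ε * a ^ i ≤ ∑ n ∈ Finset.range m, (s (i + f n) : ℝ)) : ENNReal.ofReal a ≤ L := by
  by_cases hLtop : L = ⊤
  · rw [hLtop]
    exact le_top
  have hs : ∀ i, (s i : ℝ) ≤ L.toReal ^ i := by
    intro i
    by_cases hi : i = 0
    · subst hi
      simp [hone]
    have h1 := hL i hi
    rw [rootSeq, one_div, ENNReal.rpow_inv_le_iff (by positivity), ENNReal.rpow_natCast] at h1
    have h2 := ENNReal.toReal_mono (ENNReal.pow_ne_top hLtop) h1
    rwa [ENNReal.toReal_natCast, ENNReal.toReal_pow] at h2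
  refine ENNReal.ofReal_le_of_le_toReal (le_of_forall_mul_pow_le (ε := ε)
    (K := ∑ n ∈ Finset.range m, L.toReal ^ f n) ha ENNReal.toReal_nonneg hε fun i => ?_)
  refine (h i).trans ?_
  rw [Finset.sum_mul]
  refine Finset.sum_le_sum fun n _ => (hs _).trans_eq ?_
  rw [pow_add, mul_comm]

end Growth

/-! ### Supermultiplicativity of length -/

section LengthGrowth

lemma len_unit {C : Type u} [Category.{v} C] [Abelian C] [MonoidalCategory C] [Simple (𝟙_ C)]
    (hlen : ∀ X : C, objLength X ≠ ⊤) : len (𝟙_ C) = 1 := by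
  apply le_antisymm
  · by_contra! h
    obtain ⟨A, i, hi, hi', hA⟩ := (hasChain_iff_le_len (hlen _) 2).2 h
    have h1 : ¬ IsZero A := (hasChain_one_iff A).1 hA
    refine hi' (isIso_of_mono_of_nonzero fun h0 => h1 ?_)
    rw [IsZero.iff_id_eq_zero, ← cancel_mono i, h0, comp_zero, comp_zero]
  · rw [Nat.one_le_iff_ne_zero, Ne, len_eq_zero_iff (hlen _)]
    exact Simple.not_isZero _

lemma growthSeq_eq_rootSeq {C : Type u} [Category.{v} C] [MonoidalCategory C]
    (hlen : ∀ X : C, objLength X ≠ ⊤) (Y : C) :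
    growthSeq Y = rootSeq fun i => len (tensorPow Y i) := by
  ext i
  rw [growthSeq, rootSeq, len, ← ENat.toENNReal_coe, ENat.natCast_toNat (hlen _)]

variable {C : Type u} [Category.{v} C] [Abelian C] [MonoidalCategory C] [MonoidalPreadditive C]
  [RigidCategory C] [Simple (𝟙_ C)]

/-- Exactness and the absence of zero divisors make A ⊗ - faithful: if A ⊗ f = 0, then A tensored
with the image of f is zero. -/
lemma reflectsIsomorphisms_tensorLeft {A : C} (hA : ¬ IsZero A) :
    (tensorLeft A).ReflectsIsomorphisms := by
  have hzero : ∀ {B D : C} (f : B ⟶ D), A ◁ f = 0 → f = 0 := by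
    intro B D f hf
    have h1 : A ◁ factorThruImage f ≫ A ◁ image.ι f = 0 := by
      rw [← MonoidalCategory.whiskerLeft_comp, image.fac, hf]
    have h2 : A ◁ factorThruImage f = 0 := by
      rwa [← cancel_mono (A ◁ image.ι f), zero_comp]
    have h3 : IsZero (A ⊗ image f) := by
      rw [IsZero.iff_id_eq_zero, ← cancel_epi (A ◁ factorThruImage f), h2, zero_comp, zero_comp]
    have h4 := (isZero_or_isZero_of_isZero_tensor h3).resolve_left hA
    rw [← image.fac f, h4.eq_of_tgt (factorThruImage f) 0, zero_comp]
  have : (tensorLeft A).Faithful :=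
    { map_injective := fun {B D f g} hfg => sub_eq_zero.1 (hzero (f - g) (by
        have h := sub_eq_zero.2 hfg
        rwa [← Functor.map_sub] at h)) }
  exact reflectsIsomorphisms_of_reflectsMonomorphisms_of_reflectsEpimorphisms _

variable (hlen : ∀ X : C, objLength X ≠ ⊤)

include hlen

/-- For `A` of length one, A ⊗ - carries strict chains in `B` to strict chains; longer `A` are cut
by a short exact sequence, along which both sides are additive. -/
lemma len_mul_len_le (A B : C) : len A * len B ≤ len (A ⊗ B) := by
  induction hn : len A using Nat.strong_induction_on generalizing A with
  | _ n ih =>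
    subst hn
    by_cases hA : IsZero A
    · rw [(len_eq_zero_iff (hlen A)).2 hA, Nat.zero_mul]
      exact Nat.zero_le _
    by_cases h1 : len A ≤ 1
    · have := reflectsIsomorphisms_tensorLeft hA
      have h2 : HasChain (len B) (A ⊗ B) :=
        ((hasChain_iff_le_len (hlen B) _).2 le_rfl).map (tensorLeft A)
      exact (mul_le_of_le_one_left (Nat.zero_le _) h1).trans ((hasChain_iff_le_len (hlen _) _).1 h2)
    · obtain ⟨A', i, hi, hi', hA'⟩ := (hasChain_iff_le_len (hlen A) 2).2 (by omega)
      have h1A' : 1 ≤ len A' := (hasChain_iff_le_len (hlen A') 1).1 hA'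
      have hS : (ShortComplex.mk i (cokernel.π i) (cokernel.condition i)).ShortExact :=
        { exact := ShortComplex.exact_cokernel i }
      have hadd := len_add hS (hlen _) (hlen _) (hlen _)
      have hadd' := len_add (hS.map_of_exact (tensorRight B)) (hlen _) (hlen _) (hlen _)
      change len A = len A' + len (cokernel i) at hadd
      change len (A ⊗ B) = len (A' ⊗ B) + len (cokernel i ⊗ B) at hadd'
      have hcok : len (cokernel i) ≠ 0 := by
        rw [Ne, len_eq_zero_iff (hlen _)]
        intro hz
        have : Epi i := Preadditive.epi_of_isZero_cokernel i hz
        exact hi' (isIso_of_mono_of_epi i)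
      rw [hadd', hadd, Nat.add_mul]
      exact Nat.add_le_add (ih _ (by omega) A' rfl) (ih _ (by omega) _ rfl)

omit [Simple (𝟙_ C)] in
lemma len_eq_of_cls_eq {A B : C} (h : cls A = cls B) : len A = len B := by
  have := clsLen_cls hlen A
  rw [h, clsLen_cls] at this
  exact_mod_cast this.symm

omit hlen [Simple (𝟙_ C)] in
lemma cls_tensorPow (Y : C) (i : ℕ) : cls (tensorPow Y i) = cls Y ^ i := by
  induction i with
  | zero => exact cls_unit
  | succ i ih => rw [pow_succ, ← ih, ← cls_tensor]; rfl

lemma len_tensorPow_mul_le (Y : C) (i j : ℕ) :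
    len (tensorPow Y i) * len (tensorPow Y j) ≤ len (tensorPow Y (i + j)) := by
  refine (len_mul_len_le hlen _ _).trans_eq (len_eq_of_cls_eq hlen ?_)
  rw [cls_tensor, cls_tensorPow, cls_tensorPow, cls_tensorPow, pow_add]

lemma len_tensorPow_zero_or_pos (Y : C) :
    (∀ i ≠ 0, len (tensorPow Y i) = 0) ∨ ∀ i, 0 < len (tensorPow Y i) := by
  by_cases hY : IsZero Y
  · left
    intro i hi
    obtain ⟨i, rfl⟩ := Nat.exists_eq_succ_of_ne_zero hi
    exact (len_eq_zero_iff (hlen _)).2 (isZero_tensor_left (tensorPow Y i) hY)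
  · right
    intro i
    rw [Nat.pos_iff_ne_zero, Ne, len_eq_zero_iff (hlen _)]
    induction i with
    | zero => exact Simple.not_isZero (𝟙_ C)
    | succ i ih => exact fun h => (isZero_or_isZero_of_isZero_tensor h).elim ih hY

lemma growthSeq_tendsto (Y : C) : Tendsto (growthSeq Y) atTop (𝓝 (growthDim Y)) ∧
    ∀ i ≠ 0, growthSeq Y i ≤ growthDim Y := by
  obtain ⟨L, hL, hL'⟩ := exists_tendsto_rootSeq (len_tensorPow_mul_le hlen Y)
    (len_tensorPow_zero_or_pos hlen Y)
  rw [← growthSeq_eq_rootSeq hlen] at hL hL'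
  have : growthDim Y = L := hL.limUnder_eq
  rw [this]
  exact ⟨hL, hL'⟩

end LengthGrowth

/-! ### Growth of X* ⊗ X from the continuants -/

section Paths

variable {C : Type u} [Category.{v} C] [Abelian C] [MonoidalCategory C] [MonoidalPreadditive C]
  [RigidCategory C]

/-- The alternating tensor products `X^{(1)} ⊗ X^{(2)} ⊗ ⋯ ⊗ X^{(t)}`. -/
def dualWord (X : C) : ℕ → C
  | 0 => 𝟙_ C
  | t + 1 => dualWord X t ⊗ iterDual X (t + 1)

lemma cls_dualWord_two_mul {X : C} (hX : Nonempty (((Xᘁ : C)ᘁ : C) ≅ X)) (i : ℕ) :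
    cls (dualWord X (2 * i)) = cls (tensorPow ((Xᘁ : C) ⊗ X) i) := by
  induction i with
  | zero => rfl
  | succ i ih =>
    have h1 : cls (dualWord X (2 * (i + 1))) =
        cls (dualWord X (2 * i)) * dualCls X (2 * i + 1) * dualCls X (2 * (i + 1)) := by
      rw [dualCls, dualCls, ← cls_tensor, ← cls_tensor]
      rfl
    rw [h1, ih, periodic_odd (dualCls_add_two hX), periodic_even (dualCls_add_two hX), mul_assoc,
      dualCls, dualCls, ← cls_tensor, ← cls_tensor]
    rfl

variable (hlen : ∀ X : C, objLength X ≠ ⊤)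

/-- The lengths of the products of alternating words and continuants, as a path-counting array. -/
noncomputable def pathLen (X : C) : ℕ → ℕ → ℝ
  | 0, _ => 0
  | n + 1, t => if n % 2 = t % 2 then
      (clsLen hlen (cls (dualWord X t) * leftContinuant (dualCls X) n) : ℝ) else 0

lemma dualCls_eq_of_mod {X : C} (hX : Nonempty (((Xᘁ : C)ᘁ : C) ≅ X)) {m n : ℕ}
    (h : m % 2 = n % 2) : dualCls X m = dualCls X n := by
  have h1 : ∀ n, dualCls X n = dualCls X (n % 2) := by
    intro n
    rcases Nat.even_or_odd' n with ⟨k, rfl | rfl⟩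
    · rw [periodic_even (dualCls_add_two hX), Nat.mul_mod_right]
    · rw [periodic_odd (dualCls_add_two hX), Nat.mul_add_mod]
  rw [h1 m, h1 n, h]

/-- The last letter X^{(t+1)} of the word is absorbed into E_n by the continuant recursion, which
needs the class of X^{(n)}; periodicity supplies it exactly when n ≡ t + 1 mod 2, and the other
entries are set to zero. -/
lemma pathLen_rec {X : C} (hX : Nonempty (((Xᘁ : C)ᘁ : C) ≅ X)) (n t : ℕ) :
    pathLen hlen X (n + 1) (t + 1) = pathLen hlen X (n + 2) t + pathLen hlen X n t := by
  have hw : cls (dualWord X (t + 1)) = cls (dualWord X t) * dualCls X (t + 1) := cls_tensor _ _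
  by_cases h : n % 2 = (t + 1) % 2
  · cases n with
    | zero =>
      simp only [pathLen, if_pos h, if_pos (show (0 + 1) % 2 = t % 2 by omega), add_zero]
      rw [hw, dualCls_eq_of_mod hX h.symm]
      simp [leftContinuant]
    | succ n =>
      simp only [pathLen, if_pos h, if_pos (show (n + 1 + 1) % 2 = t % 2 by omega),
        if_pos (show n % 2 = t % 2 by omega)]
      rw [hw, dualCls_eq_of_mod hX h.symm, leftContinuant, mul_sub, map_sub, mul_assoc]
      push_cast
      ring
  · cases n with
    | zero =>
      simp only [pathLen, if_neg h, if_neg (show ¬ (0 + 1) % 2 = t % 2 by omega), add_zero]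
    | succ n =>
      simp only [pathLen, if_neg h, if_neg (show ¬ (n + 1 + 1) % 2 = t % 2 by omega),
        if_neg (show ¬ n % 2 = t % 2 by omega), add_zero]

/-- Vertex m + 1 carries E_m, whose class is known from the nonvanishing of the earlier terms alone.
-/
lemma pathLen_nonneg [Simple (𝟙_ C)] {X : C} {m : ℕ} (h : ∀ j < m, ¬ IsZero (lowerObj X j)) (n : ℕ)
    (hn : n ≤ m + 1) (t : ℕ) : 0 ≤ pathLen hlen X n t := by
  cases n with
  | zero => exact le_rfl
  | succ n =>
    simp only [pathLen]
    split_ifs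
    · rw [← cls_lowerObj X n fun j hj => h j (by omega), ← cls_tensor, clsLen_cls]
      exact_mod_cast Nat.zero_le _
    · exact le_rfl

lemma pathLen_one_two_mul {X : C} (hX : Nonempty (((Xᘁ : C)ᘁ : C) ≅ X)) (i : ℕ) :
    pathLen hlen X 1 (2 * i) = len (tensorPow ((Xᘁ : C) ⊗ X) i) := by
  simp only [pathLen]
  rw [if_pos (by omega), leftContinuant, mul_one, cls_dualWord_two_mul hX, clsLen_cls]
  norm_cast

lemma pathLen_one_le {X : C} (hX : Nonempty (((Xᘁ : C)ᘁ : C) ≅ X)) (t : ℕ) :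
    pathLen hlen X 1 t ≤ len (tensorPow ((Xᘁ : C) ⊗ X) (t / 2)) := by
  rcases Nat.even_or_odd' t with ⟨k, rfl | rfl⟩
  · rw [pathLen_one_two_mul hlen hX, Nat.mul_div_cancel_left _ two_pos]
  · simp only [pathLen]
    rw [if_neg (by omega)]
    positivity

variable [Simple (𝟙_ C)]

include hlen

lemma le_growthDim {X : C} (hX : Nonempty (((Xᘁ : C)ᘁ : C) ≅ X)) {m : ℕ} (hm : 0 < m)
    (h : ∀ j < m, ¬ IsZero (lowerObj X j)) :
    ENNReal.ofReal ((2 * Real.cos (Real.pi / (m + 1 : ℕ))) ^ 2) ≤ growthDim ((Xᘁ : C) ⊗ X) := by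
  have hL := (growthSeq_tendsto hlen ((Xᘁ : C) ⊗ X)).2
  rw [growthSeq_eq_rootSeq hlen] at hL
  -- Two letters of the alternating word make one factor X* ⊗ X: time is 2i, and a shift by n
  -- becomes n / 2.
  refine le_limit_rootSeq (len_unit hlen) hL (sin_pi_div_pos hm) (by positivity) m (fun n => n / 2)
    fun i => ?_
  have h1 := pow_le_sum_path (fun _ => rfl) (pathLen_rec hlen hX) hm (pathLen_nonneg hlen h) (by
    rw [show 0 = 2 * 0 from rfl, pathLen_one_two_mul hlen hX]
    exact_mod_cast (len_unit hlen).ge) (2 * i)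
  rw [← pow_mul]
  refine h1.trans (Finset.sum_le_sum fun n _ => (pathLen_one_le hlen hX _).trans_eq ?_)
  rw [Nat.mul_add_div two_pos]

lemma growthDim_le {X : C} (hX : Nonempty (((Xᘁ : C)ᘁ : C) ≅ X)) {m : ℕ} (hm : 0 < m)
    (h : ∀ j < m, ¬ IsZero (lowerObj X j)) (hzero : IsZero (lowerObj X m)) :
    growthDim ((Xᘁ : C) ⊗ X) ≤ ENNReal.ofReal ((2 * Real.cos (Real.pi / (m + 1 : ℕ))) ^ 2) := by
  have hL := (growthSeq_tendsto hlen ((Xᘁ : C) ⊗ X)).1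
  rw [growthSeq_eq_rootSeq hlen] at hL
  obtain ⟨K, hK⟩ := exists_path_le (fun _ => rfl) (pathLen_rec hlen hX) hm
    (fun n hn => pathLen_nonneg hlen h n (by omega)) (fun t => by
      simp only [pathLen]
      rw [← cls_lowerObj X m h, cls_isZero hzero, mul_zero, map_zero, Int.cast_zero, ite_self])
  refine limit_rootSeq_le (len_tensorPow_mul_le hlen _) (len_unit hlen) hL (K := K) (by positivity)
    fun i => ?_
  rw [← pathLen_one_two_mul hlen hX, ← pow_mul]
  exact hK (2 * i)

lemma le_dualGrowth {X : C} (hX : Nonempty (((Xᘁ : C)ᘁ : C) ≅ X)) {m : ℕ} (hm : 0 < m)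
    (h : ∀ j < m, ¬ IsZero (lowerObj X j)) :
    ENNReal.ofReal (2 * Real.cos (Real.pi / (m + 1 : ℕ))) ≤ dualGrowth X := by
  rw [dualGrowth, one_div, ENNReal.le_rpow_inv_iff two_pos, ENNReal.rpow_two,
    ← ENNReal.ofReal_pow (two_cos_nonneg hm)]
  exact le_growthDim hlen hX hm h

lemma dualGrowth_le {X : C} (hX : Nonempty (((Xᘁ : C)ᘁ : C) ≅ X)) {m : ℕ} (hm : 0 < m)
    (h : ∀ j < m, ¬ IsZero (lowerObj X j)) (hzero : IsZero (lowerObj X m)) :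
    dualGrowth X ≤ ENNReal.ofReal (2 * Real.cos (Real.pi / (m + 1 : ℕ))) := by
  rw [dualGrowth, one_div, ENNReal.rpow_inv_le_iff two_pos, ENNReal.rpow_two,
    ← ENNReal.ofReal_pow (two_cos_nonneg hm)]
  exact growthDim_le hlen hX hm h hzero

/-- The lower bounds 2cos(π/(m+1)) hold for every positive m and tend to 2. -/
lemma two_le_dualGrowth {X : C} (hX : Nonempty (((Xᘁ : C)ᘁ : C) ≅ X))
    (h : ∀ j, ¬ IsZero (lowerObj X j)) : 2 ≤ dualGrowth X := by
  have h1 : Tendsto (fun m : ℕ => 2 * Real.cos (Real.pi / (m + 1 : ℕ))) atTop (𝓝 2) := by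
    have h2 : Tendsto (fun m : ℕ => Real.pi / (m + 1 : ℕ)) atTop (𝓝 0) :=
      (tendsto_const_div_atTop_nhds_zero_nat Real.pi).comp (tendsto_add_atTop_nat 1)
    have h3 := ((Real.continuous_cos.tendsto 0).comp h2).const_mul 2
    rwa [Real.cos_zero, mul_one] at h3
  have h2 := ENNReal.tendsto_ofReal h1
  rw [ENNReal.ofReal_ofNat] at h2
  refine le_of_tendsto h2 ?_
  filter_upwards [eventually_gt_atTop 0] with m hm
  exact le_dualGrowth hlen hX hm fun j _ => h j

lemma isNBounded_succ_iff {X : C} (hX : Nonempty (((Xᘁ : C)ᘁ : C) ≅ X)) {n : ℕ}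
    (h : ∀ m < n, ¬ IsZero (lowerObj X m)) : IsNBounded X (n + 1) ↔ IsZero (lowerObj X n) := by
  have h' : ∀ m < n, ¬ IsZero (upperObj X m) := by
    intro m
    induction m using Nat.strong_induction_on with
    | _ m ih =>
      intro hm
      rw [← isZero_lowerObj_iff_upperObj hlen hX m (fun j hj => h j (by omega))
        fun j hj => ih j hj (by omega)]
      exact h m hm
  rw [IsNBounded, Nat.add_sub_cancel, acyclic_lowerContinuant_iff X n h,
    acyclic_upperContinuant_iff X n h', ← isZero_lowerObj_iff_upperObj hlen hX n h h', and_self]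
  exact and_iff_right n.succ_pos

end Paths

lemma two_cos_pi_div_lt_two {N : ℕ} (hN : 0 < N) : 2 * Real.cos (Real.pi / N) < 2 := by
  have h1 : (1 : ℝ) ≤ N := by exact_mod_cast hN
  have h2 := Real.cos_lt_cos_of_nonneg_of_le_pi le_rfl (div_le_self Real.pi_pos.le h1)
    (div_pos Real.pi_pos (by linarith))
  rw [Real.cos_zero] at h2
  linarith

lemma cos_pi_div_inj {M N : ℕ} (hM : 0 < M) (hN : 0 < N)
    (h : Real.cos (Real.pi / M) = Real.cos (Real.pi / N)) : M = N := by
  have hM' : (1 : ℝ) ≤ M := by exact_mod_cast hM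
  have hN' : (1 : ℝ) ≤ N := by exact_mod_cast hN
  have h1 := Real.injOn_cos ⟨by positivity, div_le_self Real.pi_pos.le hM'⟩
    ⟨by positivity, div_le_self Real.pi_pos.le hN'⟩ h
  rw [div_eq_div_iff (by positivity) (by positivity)] at h1
  exact_mod_cast (mul_left_cancel₀ Real.pi_ne_zero h1).symm

end TensorBounded

theorem theorem5p2 {k : Type w} [Field k] {C : Type u} [Category.{v} C] [Abelian C]
    [Linear k C] [MonoidalCategory C] [MonoidalPreadditive C] [MonoidalLinear k C]
    [RigidCategory C] [TensorBounded.IsTensorCategory k C]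
    (X : C) (hX : Nonempty (((Xᘁ : C)ᘁ : C) ≅ X)) (N : ℕ) (hN : 0 < N) :
    Tendsto (TensorBounded.growthSeq ((Xᘁ : C) ⊗ X)) atTop
      (𝓝 (TensorBounded.growthDim ((Xᘁ : C) ⊗ X))) ∧
    (TensorBounded.IsStrictlyNBounded X N ↔
      (TensorBounded.dualGrowth X : EReal) = ((2 * Real.cos (Real.pi / N) : ℝ) : EReal)) ∧
    (TensorBounded.IsUnbounded X ↔ 2 ≤ TensorBounded.dualGrowth X) := by
  have hlen : ∀ X : C, TensorBounded.objLength X ≠ ⊤ :=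
    TensorBounded.IsTensorCategory.objLength_ne_top (k := k)
  have : Simple (𝟙_ C) := TensorBounded.simple_unit (k := k) inferInstance
  refine ⟨(TensorBounded.growthSeq_tendsto hlen _).1, ?_⟩
  -- If `m` is the first vanishing index, the strict bound is m + 1, and m > 0 because E_0 = 𝟙 is
  -- nonzero.
  by_cases hz : ∃ m, Limits.IsZero (TensorBounded.lowerObj X m)
  · obtain ⟨m, hm, hmin⟩ : ∃ m, Limits.IsZero (TensorBounded.lowerObj X m) ∧
        ∀ j < m, ¬ Limits.IsZero (TensorBounded.lowerObj X j) := by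
      classical
      exact ⟨Nat.find hz, Nat.find_spec hz, fun j hj => Nat.find_min hz hj⟩
    have hm0 : 0 < m := Nat.pos_of_ne_zero fun h =>
      TensorBounded.not_isZero_lowerObj_zero X (h ▸ hm)
    have hD : TensorBounded.dualGrowth X =
        ENNReal.ofReal (2 * Real.cos (Real.pi / (m + 1 : ℕ))) :=
      le_antisymm (TensorBounded.dualGrowth_le hlen hX hm0 hmin hm)
        (TensorBounded.le_dualGrowth hlen hX hm0 hmin)
    have hb : TensorBounded.IsNBounded X (m + 1) :=
      (TensorBounded.isNBounded_succ_iff hlen hX hmin).2 hm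
    have hnb : ∀ j < m + 1, ¬ TensorBounded.IsNBounded X j := by
      intro j hj hjb
      cases j with
      | zero => exact absurd hjb.1 (lt_irrefl 0)
      | succ j =>
        exact hmin j (by omega) ((TensorBounded.isNBounded_succ_iff hlen hX
          fun i hi => hmin i (by omega)).1 hjb)
    refine ⟨?_, fun h => absurd hb (h _), fun h => ?_⟩
    -- Comparing in `EReal` keeps N = 1 honest: there the right-hand side is -2, which a truncation
    -- to [0, ∞] would confuse with the value 0 at N = 2.
    · rw [hD, EReal.coe_ennreal_ofReal, max_eq_left (TensorBounded.two_cos_nonneg hm0),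
        EReal.coe_eq_coe_iff]
      constructor
      · rintro ⟨hNb, hNmin⟩
        have : N = m + 1 := le_antisymm (not_lt.1 fun h => hNmin _ h hb)
          (not_lt.1 fun h => hnb _ h hNb)
        rw [this]
      · intro h
        have : m + 1 = N := TensorBounded.cos_pi_div_inj m.succ_pos hN (by linarith)
        rw [← this]
        exact ⟨hb, hnb⟩
    · rw [hD, ← ENNReal.ofReal_ofNat, ENNReal.ofReal_le_ofReal_iff
        (TensorBounded.two_cos_nonneg hm0)] at h
      exact absurd h (TensorBounded.two_cos_pi_div_lt_two m.succ_pos).not_ge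
  · push Not at hz
    have hD := TensorBounded.two_le_dualGrowth hlen hX hz
    have hub : TensorBounded.IsUnbounded X := by
      intro j hj
      cases j with
      | zero => exact absurd hj.1 (lt_irrefl 0)
      | succ j => exact hz j ((TensorBounded.isNBounded_succ_iff hlen hX fun i _ => hz i).1 hj)
    refine ⟨⟨fun h => absurd h.1 (hub N), fun h => ?_⟩, fun _ => hD, fun _ => hub⟩
    have h1 : ((2 : ℝ≥0∞) : EReal) ≤ (TensorBounded.dualGrowth X : EReal) :=
      EReal.coe_ennreal_le_coe_ennreal_iff.2 hD
    rw [h] at h1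
    have h2 : (2 : ℝ) ≤ 2 * Real.cos (Real.pi / N) := EReal.coe_le_coe_iff.1 h1
    exact absurd h2 (TensorBounded.two_cos_pi_div_lt_two hN).not_ge
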